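/- Let $k$ be a field and $G$ a group. A $k$-category is a small category whose morphism sets ${}_y\mathcal C_x=\mathrm{Hom}(x,y)$ are $k$-vector spaces and whose composition is $k$-bilinear. Let $\mathcal C$ be a $k$-category on which $G$ acts by $k$-linear automorphisms, and suppose that the action is free on objects: $sx=x$ for an object $x$ and $s\in G$ only if $s=1$. The Hochschild–Mitchell complex $C_\bullet(\mathcal B)$ of a $k$-category $\mathcal B$ is $$C_n(\mathcal B)=\bigoplus_{x_0,\dots,x_n\in\mathcal B_0}{}_{x_0}\mathcal B_{x_n}\otimes\cdots\otimes{}_{x_2}\mathcal B_{x_1}\otimes{}_{x_1}\mathcal B_{x_0}$$ with the usual Hochschild boundary $$d(f_n\otimes\cdots\otimes f_0)=\sum_{i=0}^{n-1}(-1)^i f_n\otimes\cdots\otimes f_{n-i}f_{n-i-1}\otimes\cdots\otimes f_0+(-1)^n f_0f_n\otimes f_{n-1}\otimes\cdots\otimes f_1 ,$$ and $HH_*(\mathcal B)$ is its homology. The group $G$ acts on $C_\bullet(\mathcal C)$ by $s(f_n\otimes\cdots\otimes f_0)=sf_n\otimes\cdots\otimes sf_0$, hence on $HH_*(\mathcal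 C)$. For a $kG$-module $M$, let $M_G=M/\langle sm-m \mid s\in G,\ m\in M\rangle$ be its coinvariants. The quotient category $\mathcal C/G$ has as objects the $G$-orbits of objects of $\mathcal C$, and its morphisms from $\alpha$ to $\beta$ are $$\Big(\bigoplus_{x\in\alpha,\,y\in\beta}{}_y\mathcal C_x\Big)_G ;$$ the composite of the class of $f\in{}_y\mathcal C_x$ with the class of $g\in{}_z\mathcal C_{y'}$, where $y$ and $y'$ lie in the same orbit, is the class of $g\circ(sf)$, where $s\in G$ is the unique element with $sy=y'$. The projection functor $\mathcal C\to\mathcal C/G$ is called a Galois covering. Let $T$ be a transversal, that is a set of objects of $\mathcal C$ that contains exactly one object $u_\alpha$ of each orbit $\alpha$. It determines a $G$-grading of $\mathcal C/G$, in which the morphisms of degree $s$ from $\alpha$ to $\beta$ are the classes of the elements of ${}_{u_\beta}\mathcal C_{su_\alpha}$ (degrees multiply under composition). Let $C^{\{1\}}_\bullet(\mathcal C/G)\subseteq C_\bullet(\mathcal C/G)$ be the subcomplex spanned by the chains $f_n\otimes\cdots\otimes f_0$ with $f_i$ homogeneous of degree $s_i$ and $s_n\cdots s_1s_0=1$, and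 let $HH^{\{1\}}_*(\mathcal C/G)$ be its homology: the component of $HH_*(\mathcal C/G)$ of the trivial conjugacy class of $G$. **Theorem.** For every Galois covering $\mathcal C\to\mathcal C/G$, and $\mathcal C/G$ graded by any transversal $T$, there are isomorphisms of $k$-vector spaces $$HH_n^{\{1\}}(\mathcal C/G)\;\cong\;H_n\big(C_\bullet(\mathcal C)_G\big)\qquad\text{for all } n\ge 0 .$$ If the coinvariants functor $M\mapsto M_G$ from $kG$-modules to $k$-vector spaces is exact, then moreover $$HH_n^{\{1\}}(\mathcal C/G)\;\cong\;HH_n(\mathcal C)_G\qquad\text{for all } n\ge 0 .$$ -/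

import Mathlib

universe u

namespace HochschildMitchell

open CategoryTheory DirectSum TensorProduct

noncomputable section

/-! ### Cyclic strings of morphisms and their faces -/

theorem val_add_one' {n : ℕ} (i : Fin (n + 1)) :
    (i + 1).val = if i.val = n then 0 else i.val + 1 := by
  rw [Fin.val_add_one]
  simp [Fin.ext_iff]

theorem val_succAbove {n : ℕ} (j : Fin (n + 1)) (i : Fin n) :
    (j.succAbove i).val = if i.val < j.val then i.val else i.val + 1 := by
  simp only [Fin.succAbove, Fin.lt_def, Fin.val_castSucc]
  split_ifs <;> simp

theorem add_one_eq_succAbove {n : ℕ} {j : Fin (n + 2)} {i : Fin (n + 1)}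
    (h : j.succAbove i + 1 = j) : j + 1 = j.succAbove (i + 1) := by
  have hi := i.isLt
  have hj := j.isLt
  rw [Fin.ext_iff, val_add_one', val_succAbove] at h
  rw [Fin.ext_iff, val_add_one', val_succAbove, val_add_one']
  split_ifs at h ⊢ <;> omega

theorem succAbove_add_one {n : ℕ} {j : Fin (n + 2)} {i : Fin (n + 1)}
    (h : j.succAbove i + 1 ≠ j) : j.succAbove i + 1 = j.succAbove (i + 1) := by
  have hi := i.isLt
  have hj := j.isLt
  rw [Ne, Fin.ext_iff, val_add_one', val_succAbove] at h
  rw [Fin.ext_iff, val_add_one', val_succAbove, val_succAbove, val_add_one']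
  split_ifs at h ⊢ <;> omega

section Strings
variable {C : Type u} [Category.{u} C]

/-- A cyclic string `x 0 ⟶ x 1 ⟶ ... ⟶ x n ⟶ x 0` of morphisms is a family
`f i : x i ⟶ x (i + 1)`, the indices being taken modulo `n + 1`. The `j`-th face of a string omits
the object `x j` and composes the two morphisms that are adjacent at `x j`. (The `eqToHom` only
identify equal indices.) -/
def face {n : ℕ} (j : Fin (n + 2)) {x : Fin (n + 2) → C} (f : ∀ i, x i ⟶ x (i + 1))
    (i : Fin (n + 1)) : x (j.succAbove i) ⟶ x (j.succAbove (i + 1)) :=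
  if h : j.succAbove i + 1 = j then
    f (j.succAbove i) ≫ eqToHom (congrArg x h) ≫ f j ≫
      eqToHom (congrArg x (add_one_eq_succAbove h))
  else f (j.succAbove i) ≫ eqToHom (congrArg x (succAbove_add_one h))

theorem val_add_one_mod {n : ℕ} (i : Fin (n + 1)) : (i + 1).val = (i.val + 1) % (n + 1) := by
  simp [Fin.val_add]

/-- The composite of `m` successive morphisms of a cyclic string, starting at index `i`. -/
def seg {n : ℕ} {x : Fin (n + 1) → C} (f : ∀ i, x i ⟶ x (i + 1)) :
    (m : ℕ) → (i j : Fin (n + 1)) → ((i.val + m) % (n + 1) = j.val) → (x i ⟶ x j)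
  | 0, i, j, h => eqToHom (congrArg x (Fin.ext
      ((Nat.mod_eq_of_lt i.isLt).symm.trans h)))
  | m + 1, i, j, h => f i ≫ seg f m (i + 1) j (by
      rw [← h, val_add_one_mod, Nat.mod_add_mod]; congr 1; omega)

/-- The morphism `g` is the composite of `m` successive morphisms of the cyclic string `f`. -/
def IsSeg {n : ℕ} {x : Fin (n + 1) → C} (f : ∀ i, x i ⟶ x (i + 1)) (m : ℕ) {i j : Fin (n + 1)}
    (g : x i ⟶ x j) : Prop :=
  ∃ h, g = seg f m i j h

theorem IsSeg.unique {n : ℕ} {x : Fin (n + 1) → C} {f : ∀ i, x i ⟶ x (i + 1)} {m m' : ℕ}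
    {i j : Fin (n + 1)} {g g' : x i ⟶ x j} (h : IsSeg f m g) (h' : IsSeg f m' g')
    (hm : 1 ≤ m ∧ m ≤ n + 1) (hm' : 1 ≤ m' ∧ m' ≤ n + 1) : g = g' := by
  obtain ⟨h, rfl⟩ := h
  obtain ⟨h', rfl⟩ := h'
  have : m = m' := by
    have hi := i.isLt
    have e : (i.val + m) % (n + 1) = (i.val + m') % (n + 1) := h.trans h'.symm
    have e2 : (m % (n + 1)) = m' % (n + 1) := Nat.ModEq.add_left_cancel' i.val e
    rcases Nat.lt_or_ge m (n + 1) with a | a <;> rcases Nat.lt_or_ge m' (n + 1) with b | b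
    · rwa [Nat.mod_eq_of_lt a, Nat.mod_eq_of_lt b] at e2
    · obtain rfl : m' = n + 1 := by omega
      rw [Nat.mod_eq_of_lt a, Nat.mod_self] at e2; omega
    · obtain rfl : m = n + 1 := by omega
      rw [Nat.mod_eq_of_lt b, Nat.mod_self] at e2; omega
    · omega
  subst this
  rfl

theorem isSeg_cast {n : ℕ} {x : Fin (n + 1) → C} (f : ∀ i, x i ⟶ x (i + 1))
    {i j : Fin (n + 1)} (h : i = j) : IsSeg f 0 (eqToHom (congrArg x h)) := by
  subst h; exact ⟨by simp [Nat.mod_eq_of_lt i.isLt], rfl⟩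

theorem isSeg_one {n : ℕ} {x : Fin (n + 1) → C} (f : ∀ i, x i ⟶ x (i + 1))
    (i : Fin (n + 1)) : IsSeg f 1 (f i) :=
  ⟨(val_add_one_mod i).symm, by simp [seg]⟩

theorem IsSeg.comp {n : ℕ} {x : Fin (n + 1) → C} {f : ∀ i, x i ⟶ x (i + 1)} {m m' : ℕ}
    {i j l : Fin (n + 1)} {g : x i ⟶ x j} {g' : x j ⟶ x l} (h : IsSeg f m g)
    (h' : IsSeg f m' g') : IsSeg f (m + m') (g ≫ g') := by
  induction m generalizing i with
  | zero =>
    obtain ⟨h, rfl⟩ := h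
    obtain rfl : i = j := Fin.ext ((Nat.mod_eq_of_lt i.isLt).symm.trans h)
    simpa [seg] using h'
  | succ m ih =>
    obtain ⟨h, rfl⟩ := h
    obtain ⟨h2, e⟩ := ih (i := i + 1) ⟨_, rfl⟩
    rw [seg, Category.assoc, e, show m + 1 + m' = m + m' + 1 by omega]
    exact ⟨by rw [← h2, val_add_one_mod, Nat.mod_add_mod]; congr 1; omega, rfl⟩

theorem isSeg_face {n : ℕ} (j : Fin (n + 2)) {x : Fin (n + 2) → C} (f : ∀ i, x i ⟶ x (i + 1))
    (i : Fin (n + 1)) : IsSeg f (if j.succAbove i + 1 = j then 2 else 1)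
      (i := j.succAbove i) (j := j.succAbove (i + 1)) (face j f i) := by
  by_cases h : j.succAbove i + 1 = j
  · rw [if_pos h, face, dif_pos h]
    exact (isSeg_one f _).comp ((isSeg_cast f h).comp ((isSeg_one f j).comp
      (isSeg_cast f (add_one_eq_succAbove h))))
  · rw [if_neg h, face, dif_neg h]
    exact (isSeg_one f _).comp (isSeg_cast f (succAbove_add_one h))

theorem isSeg_face_face {n : ℕ} (j : Fin (n + 3)) (j' : Fin (n + 2)) {x : Fin (n + 3) → C}
    (f : ∀ i, x i ⟶ x (i + 1)) (i : Fin (n + 1)) : ∃ m, 1 ≤ m ∧ m ≤ n + 3 ∧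
      IsSeg f m (i := j.succAbove (j'.succAbove i)) (j := j.succAbove (j'.succAbove (i + 1)))
        (face (x := fun i => x (j.succAbove i)) j' (face j f) i) := by
  have key : ∀ i l (h : i = l), IsSeg f 0 (i := j.succAbove i) (j := j.succAbove l)
    (eqToHom (congrArg (fun i => x (j.succAbove i)) h)) := fun i l h =>
      isSeg_cast f (congrArg j.succAbove h)
  by_cases h : j'.succAbove i + 1 = j'
  · rw [face, dif_pos h]
    refine ⟨_, ?_, ?_, (isSeg_face j f _).comp ((key _ _ h).comp
      ((isSeg_face j f j').comp (key _ _ (add_one_eq_succAbove h))))⟩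
    · split_ifs <;> omega
    · split_ifs with h1 h2
      · exfalso
        have h3 := h1.trans h2.symm
        have := Fin.succAbove_right_injective (add_right_cancel h3)
        exact Fin.succAbove_ne _ _ this
      all_goals omega
  · rw [face, dif_neg h]
    refine ⟨_, ?_, ?_, (isSeg_face j f _).comp (key _ _ (succAbove_add_one h))⟩ <;> split_ifs <;> omega

theorem succAbove_succAbove {n : ℕ} {i j : Fin (n + 2)} (h : i ≤ j) (a : Fin (n + 1)) :
    j.succ.succAbove (i.succAbove a) = i.castSucc.succAbove (j.succAbove a) := by
  have := SimplexCategory.δ_comp_δ h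
  exact congrArg (fun g => g.toOrderHom a) this

theorem IsSeg.heq {n : ℕ} {x : Fin (n + 1) → C} {f : ∀ i, x i ⟶ x (i + 1)} {m m' : ℕ}
    {i j i' j' : Fin (n + 1)} {g : x i ⟶ x j} {g' : x i' ⟶ x j'} (hi : i = i') (hj : j = j')
    (h : IsSeg f m g) (h' : IsSeg f m' g')
    (hm : 1 ≤ m ∧ m ≤ n + 1) (hm' : 1 ≤ m' ∧ m' ≤ n + 1) : HEq g g' := by
  subst hi hj
  exact heq_of_eq (h.unique h' hm hm')

theorem face_face {n : ℕ} {i j : Fin (n + 2)} (h : i ≤ j) {x : Fin (n + 3) → C}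
    (f : ∀ i, x i ⟶ x (i + 1)) :
    HEq (face (x := fun a => x (j.succ.succAbove a)) i (face j.succ f))
      (face (x := fun a => x (i.castSucc.succAbove a)) j (face i.castSucc f)) := by
  refine Function.hfunext rfl ?_
  rintro a _ ⟨⟩
  obtain ⟨m, h1, h2, h3⟩ := isSeg_face_face j.succ i f a
  obtain ⟨m', h1', h2', h3'⟩ := isSeg_face_face i.castSucc j f a
  exact h3.heq (succAbove_succAbove h _) (succAbove_succAbove h _) h3' ⟨h1, h2⟩ ⟨h1', h2'⟩

end Strings

section Tensor
variable {k : Type u} [Field k] {ι : Type} {V : ι → Type u} [∀ i, AddCommGroup (V i)]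
  [∀ i, Module k (V i)]

theorem tprod_add_of (i₀ : ι) {F U W : ∀ i, V i} (h₀ : F i₀ = U i₀ + W i₀)
    (hU : ∀ i, i ≠ i₀ → U i = F i) (hW : ∀ i, i ≠ i₀ → W i = F i) :
    PiTensorProduct.tprod k F = PiTensorProduct.tprod k U + PiTensorProduct.tprod k W := by
  classical
  have e1 : U = Function.update F i₀ (U i₀) := by
    funext i; by_cases h : i = i₀
    · subst h; simp
    · simp [h, hU i h]
  have e2 : W = Function.update F i₀ (W i₀) := by
    funext i; by_cases h : i = i₀
    · subst h; simp
    · simp [h, hW i h]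
  have e3 : F = Function.update F i₀ (U i₀ + W i₀) := by
    rw [← h₀, Function.update_eq_self]
  rw [e3, MultilinearMap.map_update_add, ← e1, ← e2]

theorem tprod_smul_of (i₀ : ι) {F U : ∀ i, V i} {c : k} (h₀ : F i₀ = c • U i₀)
    (hU : ∀ i, i ≠ i₀ → U i = F i) :
    PiTensorProduct.tprod k F = c • PiTensorProduct.tprod k U := by
  classical
  have e1 : U = Function.update F i₀ (U i₀) := by
    funext i; by_cases h : i = i₀
    · subst h; simp
    · simp [h, hU i h]
  have e3 : F = Function.update F i₀ (c • U i₀) := by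
    rw [← h₀, Function.update_eq_self]
  rw [e3, MultilinearMap.map_update_smul, ← e1]

end Tensor

/-! ### The Hochschild-Mitchell complex -/

section Chains
variable (k : Type u) [Field k] (C : Type u) [Category.{u} C] [Preadditive C] [Linear k C]

/-- `C_n(C)`: the direct sum, over all `x 0, ..., x n`, of the tensor products
`Hom (x n, x 0) ⊗ ... ⊗ Hom (x 1, x 2) ⊗ Hom (x 0, x 1)`. -/
abbrev Chains (n : ℕ) : Type u :=
  ⨁ x : Fin (n + 1) → C, ⨂[k] i, (x i ⟶ x (i + 1))

variable {C}

/-- The elementary chain `f n ⊗ ... ⊗ f 1 ⊗ f 0`. -/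
def elem {n : ℕ} {x : Fin (n + 1) → C} (f : ∀ i, x i ⟶ x (i + 1)) : Chains k C n := by
  classical
  exact DirectSum.lof k (Fin (n + 1) → C) (fun x => ⨂[k] i, (x i ⟶ x (i + 1))) x
    (PiTensorProduct.tprod k f)

variable {k} in
theorem elem_congr {n : ℕ} {x y : Fin (n + 1) → C} {f : ∀ i, x i ⟶ x (i + 1)}
    {g : ∀ i, y i ⟶ y (i + 1)} (h : x = y) (h' : HEq f g) : elem k f = elem k g := by
  subst h
  rw [eq_of_heq h']

variable {k} in
theorem chains_hom_ext {n : ℕ} {W : Type u} [AddCommGroup W] [Module k W]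
    {φ ψ : Chains k C n →ₗ[k] W}
    (h : ∀ (x : Fin (n + 1) → C) (f : ∀ i, x i ⟶ x (i + 1)), φ (elem k f) = ψ (elem k f)) :
    φ = ψ := by
  classical
  refine DirectSum.linearMap_ext k fun x => PiTensorProduct.ext ?_
  ext f
  exact h x f

theorem face_update {n : ℕ} (j : Fin (n + 2)) {x : Fin (n + 2) → C} [DecidableEq (Fin (n + 2))]
    (f : ∀ i, x i ⟶ x (i + 1)) (i : Fin (n + 2)) : ∃ i₀ : Fin (n + 1),
      (∀ a, a ≠ i₀ → ∀ v w, face j (Function.update f i v) a = face j (Function.update f i w) a) ∧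
      (∀ v w, face j (Function.update f i (v + w)) i₀ =
        face j (Function.update f i v) i₀ + face j (Function.update f i w) i₀) ∧
      (∀ (c : k) v, face j (Function.update f i (c • v)) i₀ =
        c • face j (Function.update f i v) i₀) := by
  by_cases hij : i = j
  · subst hij
    have hne : i - 1 ≠ i := by
      intro h
      have := congrArg (fun a => i - a) h
      simp at this
    obtain ⟨i₀, h₀⟩ := Fin.exists_succAbove_eq hne
    have h1 : i.succAbove i₀ + 1 = i := by rw [h₀]; simp
    refine ⟨i₀, ?_, ?_, ?_⟩
    · intro a ha v w
      have h2 : ¬ (i.succAbove a + 1 = i) := fun h =>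
        ha (Fin.succAbove_right_injective (add_right_cancel (h.trans h1.symm)))
      simp only [face, dif_neg h2, Function.update_of_ne (Fin.succAbove_ne i a)]
    · intro v w
      simp only [face, dif_pos h1, Function.update_of_ne (Fin.succAbove_ne i i₀),
        Function.update_self, Preadditive.add_comp, Preadditive.comp_add]
    · intro c v
      simp only [face, dif_pos h1, Function.update_of_ne (Fin.succAbove_ne i i₀),
        Function.update_self, Linear.smul_comp, Linear.comp_smul]
  · obtain ⟨i₀, rfl⟩ := Fin.exists_succAbove_eq hij
    have hj : j ≠ j.succAbove i₀ := (Fin.succAbove_ne j i₀).symm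
    refine ⟨i₀, ?_, ?_, ?_⟩
    · intro a ha v w
      have h2 : j.succAbove a ≠ j.succAbove i₀ := fun h => ha (Fin.succAbove_right_injective h)
      simp only [face, Function.update_of_ne h2, Function.update_of_ne hj]
    · intro v w
      simp only [face, Function.update_of_ne hj, Function.update_self]
      split_ifs <;> simp only [Preadditive.add_comp]
    · intro c v
      simp only [face, Function.update_of_ne hj, Function.update_self]
      split_ifs <;> simp only [Linear.smul_comp]

/-- The `j`-th face, as a multilinear map of the morphisms of a string. -/
def faceMultilinear {n : ℕ} (j : Fin (n + 2)) (x : Fin (n + 2) → C) :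
    MultilinearMap k (fun i => x i ⟶ x (i + 1))
      (⨂[k] i, (x (j.succAbove i) ⟶ x (j.succAbove (i + 1)))) where
  toFun f := PiTensorProduct.tprod k (face j f)
  map_update_add' f i v w := by
    obtain ⟨i₀, h1, h2, -⟩ := face_update k j f i
    exact tprod_add_of i₀ (h2 v w) (fun a ha => h1 a ha _ _) (fun a ha => h1 a ha _ _)
  map_update_smul' f i c v := by
    obtain ⟨i₀, h1, -, h2⟩ := face_update k j f i
    exact tprod_smul_of i₀ (h2 c v) (fun a ha => h1 a ha _ _)

variable (C)

/-- The `j`-th face, as a linear map on chains. -/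
def faceLinear (n : ℕ) (j : Fin (n + 2)) : Chains k C (n + 1) →ₗ[k] Chains k C n := by
  classical
  exact DirectSum.toModule k _ _ fun x =>
    DirectSum.lof k (Fin (n + 1) → C) (fun x => ⨂[k] i, (x i ⟶ x (i + 1)))
      (fun i => x (j.succAbove i)) ∘ₗ PiTensorProduct.lift (faceMultilinear k j x)

variable {C} in
@[simp]
theorem faceLinear_elem {n : ℕ} (j : Fin (n + 2)) {x : Fin (n + 2) → C}
    (f : ∀ i, x i ⟶ x (i + 1)) :
    faceLinear k C n j (elem k f) = elem k (x := fun i => x (j.succAbove i)) (face j f) := by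
  classical
  rw [faceLinear, elem, elem, DirectSum.toModule_lof, LinearMap.comp_apply,
    PiTensorProduct.lift.tprod]
  rfl

/-- The Hochschild boundary: `d (f_n ⊗ ... ⊗ f_0)`, where `n` is the degree, equals
`f_n f_{n-1} ⊗ ... ⊗ f_0 - f_n ⊗ f_{n-1} f_{n-2} ⊗ ... ⊗ f_0 + ... + (-1)^n f_0 f_n ⊗ ... ⊗ f_1`,
so the face that omits the object `x_j` has the sign `(-1)^(n - j) = (-1)^(n + j)`. -/
def boundary (n : ℕ) : Chains k C (n + 1) →ₗ[k] Chains k C n :=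
  ∑ j : Fin (n + 2), (-1 : k) ^ (n + 1 + j.val) • faceLinear k C n j

theorem faceLinear_comp_faceLinear {n : ℕ} {i j : Fin (n + 2)} (h : i ≤ j) :
    faceLinear k C n i ∘ₗ faceLinear k C (n + 1) j.succ =
      faceLinear k C n j ∘ₗ faceLinear k C (n + 1) i.castSucc :=
  chains_hom_ext fun x f => by
    simp only [LinearMap.comp_apply, faceLinear_elem]
    exact elem_congr (funext fun a => congrArg x (succAbove_succAbove h a)) (face_face h f)

theorem boundary_comp_boundary (n : ℕ) : boundary k C n ∘ₗ boundary k C (n + 1) = 0 := by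
  have expand : boundary k C n ∘ₗ boundary k C (n + 1) =
      ∑ i : Fin (n + 2), ∑ j : Fin (n + 3), (-1 : k) ^ (n + 1 + i.val + (n + 1 + 1 + j.val)) •
        (faceLinear k C n i ∘ₗ faceLinear k C (n + 1) j) := by
    refine LinearMap.ext fun v => ?_
    simp only [boundary, LinearMap.comp_apply, LinearMap.sum_apply, map_sum, map_smul,
      LinearMap.smul_apply, smul_smul, Finset.smul_sum, pow_add]
    rw [Finset.sum_comm]
    refine Finset.sum_congr rfl fun i _ => Finset.sum_congr rfl fun j _ => ?_
    congr 1
    ring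
  rw [expand, ← Finset.sum_product']
  let P := Fin (n + 2) × Fin (n + 3)
  let S : Finset P := {ij : P | (ij.2 : ℕ) ≤ (ij.1 : ℕ)}
  rw [Finset.univ_product_univ, ← Finset.sum_add_sum_compl S]
  refine (eq_neg_iff_add_eq_zero (G := Chains k C (n + 1 + 1) →ₗ[k] Chains k C n)).mp ?_
  refine Eq.trans ?_ (Finset.sum_neg_distrib (G := Chains k C (n + 1 + 1) →ₗ[k] Chains k C n)
    (fun ij : P => (-1 : k) ^ (n + 1 + ij.1.val + (n + 1 + 1 + ij.2.val)) •
        (faceLinear k C n ij.1 ∘ₗ faceLinear k C (n + 1) ij.2)))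
  let φ : ∀ ij : P, ij ∈ S → P := fun ij hij =>
    (Fin.castLT ij.2 (lt_of_le_of_lt (Finset.mem_filter.mp hij).right (Fin.is_lt ij.1)), ij.1.succ)
  apply Finset.sum_bij φ
  · intro ij hij
    simp_rw [S, φ, Finset.compl_filter, Finset.mem_filter_univ, Fin.val_succ,
      Fin.val_castLT] at hij ⊢
    lia
  · rintro ⟨i, j⟩ hij ⟨i', j'⟩ hij' h
    rw [Prod.mk_inj]
    exact ⟨by simpa [φ] using! congr_arg Prod.snd h,
      by simpa [φ, Fin.castSucc_castLT] using! congr_arg Fin.castSucc (congr_arg Prod.fst h)⟩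
  · rintro ⟨i', j'⟩ hij'
    simp_rw [S, Finset.compl_filter, Finset.mem_filter_univ, not_le] at hij'
    refine ⟨(j'.pred <| ?_, Fin.castSucc i'), ?_, ?_⟩
    · rintro rfl
      simp only [Fin.val_zero, not_lt_zero] at hij'
    · simpa [S] using! Nat.le_sub_one_of_lt hij'
    · simp only [φ, Fin.castLT_castSucc, Fin.succ_pred]
  · rintro ⟨i, j⟩ hij
    have hij' : (j : ℕ) ≤ (i : ℕ) := by simpa [S] using hij
    obtain ⟨j, rfl⟩ : ∃ j' : Fin (n + 2), j = j'.castSucc :=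
      ⟨Fin.castLT j (lt_of_le_of_lt hij' i.isLt), rfl⟩
    simp only [φ, Fin.castLT_castSucc]
    rw [faceLinear_comp_faceLinear k C (i := j) (j := i) hij']
    refine Eq.trans ?_ (neg_smul (M := Chains k C (n + 1 + 1) →ₗ[k] Chains k C n) _ _)
    congr 1
    simp only [Fin.val_succ, Fin.val_castSucc, pow_add, pow_one]
    ring

end Chains

/-! ### Group actions -/

section PermRep
variable {k G I : Type u} [Field k] [Group G] [MulAction G I] {V : I → Type u}
  [∀ i, AddCommGroup (V i)] [∀ i, Module k (V i)] [DecidableEq I]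

/-- The representation on a direct sum `⨁ i, V i` for a group that permutes the indices and acts
by compatible linear maps `V i → V (s • i)`. -/
def permRep (a : ∀ (s : G) (i : I), V i →ₗ[k] V (s • i))
    (h_one : ∀ i, lof k I V _ ∘ₗ a 1 i = lof k I V i)
    (h_mul : ∀ s t i, lof k I V _ ∘ₗ a (s * t) i = lof k I V _ ∘ₗ a s (t • i) ∘ₗ a t i) :
    Representation k G (⨁ i, V i) where
  toFun s := DirectSum.toModule k I _ fun i => lof k I V (s • i) ∘ₗ a s i
  map_one' := DirectSum.linearMap_ext k fun i => LinearMap.ext fun v => by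
    simpa using congrArg (fun φ => φ v) (h_one i)
  map_mul' s t := DirectSum.linearMap_ext k fun i => LinearMap.ext fun v => by
    simpa using congrArg (fun φ => φ v) (h_mul s t i)

theorem permRep_lof (a : ∀ (s : G) (i : I), V i →ₗ[k] V (s • i)) (h_one) (h_mul) (s : G) (i : I)
    (v : V i) : permRep a h_one h_mul s (lof k I V i v) = lof k I V (s • i) (a s i v) := by
  change DirectSum.toModule k I _ (fun i => lof k I V (s • i) ∘ₗ a s i) _ = _
  rw [DirectSum.toModule_lof]
  rfl

end PermRep

/-- A `G`-`k`-category: a `k`-category `C` with an action of `G` by `k`-linear automorphisms.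
The action on objects is the `MulAction`, and `act s f : s • x ⟶ s • y` is the action on
morphisms `f : x ⟶ y`. (The `eqToHom` only identify `1 • x = x` and `(s * t) • x = s • t • x`.) -/
class GKCategory (k G C : Type u) [Field k] [Group G] [Category.{u} C] [Preadditive C]
    [Linear k C] [MulAction G C] where
  act (s : G) {x y : C} : (x ⟶ y) →ₗ[k] (s • x ⟶ s • y)
  act_id (s : G) (x : C) : act s (𝟙 x) = 𝟙 (s • x)
  act_comp (s : G) {x y z : C} (f : x ⟶ y) (g : y ⟶ z) : act s (f ≫ g) = act s f ≫ act s g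
  act_one {x y : C} (f : x ⟶ y) :
    act 1 f = eqToHom (one_smul G x) ≫ f ≫ eqToHom (one_smul G y).symm
  act_mul (s t : G) {x y : C} (f : x ⟶ y) :
    act (s * t) f = eqToHom (mul_smul s t x) ≫ act s (act t f) ≫ eqToHom (mul_smul s t y).symm

theorem eqToHom_heq {C : Type u} [Category.{u} C] {x y x' y' : C} (hx : x' = x) (hy : y = y') (f : x ⟶ y) :
    HEq (eqToHom hx ≫ f ≫ eqToHom hy) f := by
  subst hx hy; simp

section Action
variable (k : Type u) {G C : Type u} [Field k] [Group G] [Category.{u} C] [Preadditive C]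
    [Linear k C] [MulAction G C] [GKCategory k G C]

open GKCategory

theorem act_eqToHom (s : G) {x y : C} (h : x = y) :
    act (k := k) s (eqToHom h) = eqToHom (congrArg (s • ·) h) := by
  subst h; simp [act_id]

theorem act_face (s : G) {n : ℕ} (j : Fin (n + 2)) {x : Fin (n + 2) → C}
    (f : ∀ i, x i ⟶ x (i + 1)) :
    face (x := fun i => s • x i) j (fun i => act (k := k) s (f i)) = fun i => act (k := k) s (face j f i) := by
  funext i
  simp only [face]
  split_ifs <;> simp [act_comp, act_eqToHom]

theorem elem_act_one {n : ℕ} {x : Fin (n + 1) → C} (f : ∀ i, x i ⟶ x (i + 1)) :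
    elem k (x := fun i => (1 : G) • x i) (fun i => act (k := k) (1 : G) (f i)) = elem k f := by
  refine elem_congr (funext fun i => one_smul G (x i)) (Function.hfunext rfl ?_)
  rintro i _ ⟨⟩
  rw [act_one]
  exact eqToHom_heq _ _ _

theorem elem_act_mul (s t : G) {n : ℕ} {x : Fin (n + 1) → C} (f : ∀ i, x i ⟶ x (i + 1)) :
    elem k (x := fun i => (s * t) • x i) (fun i => act (k := k) (s * t) (f i)) =
      elem k (x := fun i => s • t • x i) (fun i => act (k := k) s (act (k := k) t (f i))) := by
  refine elem_congr (funext fun i => mul_smul s t (x i)) (Function.hfunext rfl ?_)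
  rintro i _ ⟨⟩
  rw [act_mul]
  exact eqToHom_heq _ _ _

variable (G C)

/-- The action of `G` on `C_n(C)`: `s (f_n ⊗ ... ⊗ f_0) = s f_n ⊗ ... ⊗ s f_0`. -/
def chainsRep (n : ℕ) : Representation k G (Chains k C n) := by
  classical
  exact permRep (I := Fin (n + 1) → C) (V := fun x => ⨂[k] i, (x i ⟶ x (i + 1)))
    (fun s x => PiTensorProduct.map (t := fun i => (s • x i ⟶ s • x (i + 1)))
      fun i => act (k := k) s)
    (fun x => PiTensorProduct.ext (MultilinearMap.ext fun f => by
      simp only [LinearMap.compMultilinearMap_apply, LinearMap.comp_apply,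
        PiTensorProduct.map_tprod]
      exact elem_act_one k f))
    (fun s t x => PiTensorProduct.ext (MultilinearMap.ext fun f => by
      simp only [LinearMap.compMultilinearMap_apply, LinearMap.comp_apply,
        PiTensorProduct.map_tprod]
      exact elem_act_mul k s t f))

variable {G C}

theorem chainsRep_elem (s : G) {n : ℕ} {x : Fin (n + 1) → C} (f : ∀ i, x i ⟶ x (i + 1)) :
    chainsRep k G C n s (elem k f) =
      elem k (x := fun i => s • x i) (fun i => act (k := k) s (f i)) := by
  classical
  rw [chainsRep, elem, permRep_lof, PiTensorProduct.map_tprod]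
  rfl

variable (G C)

theorem boundary_chainsRep (n : ℕ) (s : G) :
    boundary k C n ∘ₗ chainsRep k G C (n + 1) s = chainsRep k G C n s ∘ₗ boundary k C n :=
  chains_hom_ext fun x f => by
    simp only [LinearMap.comp_apply, chainsRep_elem, boundary, LinearMap.sum_apply, map_sum,
      LinearMap.smul_apply, map_smul, faceLinear_elem]
    refine Finset.sum_congr rfl fun j _ => ?_
    rw [act_face]

/-- The Hochschild-Mitchell complex of a `G`-`k`-category, as a complex of `kG`-modules. -/
def chainComplexRep : ChainComplex (Rep.{u} k G) ℕ :=
  ChainComplex.of (fun n => Rep.of (chainsRep k G C n))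
    (fun n => Rep.ofHom ⟨boundary k C n, boundary_chainsRep k G C n⟩) (fun n => by
      exact Rep.hom_ext (Representation.IntertwiningMap.ext (boundary_comp_boundary k C n)))

/-- The Hochschild-Mitchell homology `HH_n(C)`, with its structure of `kG`-module. -/
def homologyRep (n : ℕ) : Rep.{u} k G := (chainComplexRep k G C).homology n

/-- The complex of coinvariants of the Hochschild-Mitchell complex of a `G`-`k`-category. -/
def coinvariantsChainComplex : ChainComplex (ModuleCat.{u} k) ℕ :=
  ((Rep.coinvariantsFunctor k G).mapHomologicalComplex _).obj (chainComplexRep k G C)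

end Action

/-- The functor of coinvariants `M ↦ M_G` from `kG`-modules to `k`-vector spaces is exact. -/
def CoinvariantsExact (k G : Type u) [Field k] [Group G] : Prop :=
  ∀ S : ShortComplex (Rep.{u} k G), S.ShortExact →
    (S.map (Rep.coinvariantsFunctor k G)).ShortExact

/-! ### Graded categories -/

/-- A `G`-grading of a `k`-category: every space of morphisms is the direct sum of its subspaces
`deg s x y` of morphisms of degree `s`, and degrees multiply under composition: the composite of
`f` of degree `s` followed by `g` of degree `t` has degree `t * s`. -/
structure Grading (k G B : Type u) [Field k] [Group G] [Category.{u} B] [Preadditive B]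
    [Linear k B] where
  deg (s : G) (x y : B) : Submodule k (x ⟶ y)
  isInternal (x y : B) : open Classical in DirectSum.IsInternal fun s => deg s x y
  comp_mem {s t : G} {x y z : B} {f : x ⟶ y} {g : y ⟶ z} :
    f ∈ deg s x y → g ∈ deg t y z → f ≫ g ∈ deg (t * s) x z

section Degrees
variable {G : Type u} [Group G]

/-- The product `s_n ... s_1 s_0`. -/
def totalDegree {n : ℕ} (s : Fin (n + 1) → G) : G := (List.ofFn fun i => s i.rev).prod

theorem prod_ofFn_telescope (p : ℕ → G) (n : ℕ) (s : Fin n → G)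
    (h : ∀ i : Fin n, s i = p (i.val + 1) * (p i.val)⁻¹) :
    (List.ofFn fun i => s i.rev).prod = p n * (p 0)⁻¹ := by
  induction n with
  | zero => simp
  | succ n ih =>
    rw [List.ofFn_succ, List.prod_cons, h]
    have e : (List.ofFn fun i : Fin n => s i.succ.rev).prod = p n * (p 0)⁻¹ := by
      have := ih (fun i => s i.castSucc) (fun i => h i.castSucc)
      rw [← this]
      congr 2
      funext i
      rw [Fin.rev_succ]
    rw [e]
    simp

/-- The degrees of the morphisms of the `j`-th face of a string with degrees `s`. -/
def faceDegree {n : ℕ} (j : Fin (n + 2)) (s : Fin (n + 2) → G) (i : Fin (n + 1)) : G :=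
  if j.succAbove i + 1 = j then s j * s (j.succAbove i) else s (j.succAbove i)

theorem isConj_totalDegree {n : ℕ} (j : Fin (n + 2)) (s : Fin (n + 2) → G) :
    IsConj (totalDegree (faceDegree j s)) (totalDegree s) := by
  let p : ℕ → G := fun m => Nat.rec 1 (fun i a => (if h : i < n + 2 then s ⟨i, h⟩ else 1) * a) m
  have hp0 : p 0 = 1 := rfl
  have hp : ∀ i : Fin (n + 2), s i = p (i.val + 1) * (p i.val)⁻¹ := by
    intro i
    have : p (i.val + 1) = (if h : i.val < n + 2 then s ⟨i, h⟩ else 1) * p i.val := rfl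
    rw [this, dif_pos i.isLt]
    simp
  have hs : totalDegree s = p (n + 2) := by
    rw [totalDegree, prod_ofFn_telescope p _ s hp, hp0]; simp
  have hcond : ∀ i : Fin (n + 1), j.succAbove i + 1 = j ↔
      (i.val + 1 = j.val ∨ (j.val = 0 ∧ i.val = n)) := by
    intro i
    have hi := i.isLt
    have hj := j.isLt
    rw [Fin.ext_iff, val_add_one', val_succAbove]
    split_ifs <;> omega
  rw [hs]
  by_cases hj : j.val = 0
  · let q : ℕ → G := fun m => if m ≤ n then p (m + 1) else p 1 * p (n + 2)
    rw [totalDegree, prod_ofFn_telescope q]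
    · have h1 : q (n + 1) = p 1 * p (n + 2) := if_neg (by omega)
      have h0 : q 0 = p 1 := if_pos (by omega)
      rw [h1, h0]
      exact (isConj_iff.mpr ⟨p 1, rfl⟩).symm
    · intro i
      have hi := i.isLt
      have hv : (j.succAbove i).val = i.val + 1 := by rw [val_succAbove, if_neg (by omega)]
      have hq : q i.val = p (i.val + 1) := if_pos (by omega)
      simp only [faceDegree, hcond]
      by_cases h : i.val = n
      · have hq' : q (i.val + 1) = p 1 * p (n + 2) := if_neg (by omega)
        rw [if_pos (Or.inr ⟨hj, h⟩), hp, hp, hv, hq, hq', hj, h, hp0]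
        simp [mul_assoc]
      · have hq' : q (i.val + 1) = p (i.val + 2) := if_pos (by omega)
        rw [if_neg (by omega), hp, hv, hq, hq']
  · let q : ℕ → G := fun m => if m < j.val then p m else p (m + 1)
    have hjl := j.isLt
    rw [totalDegree, prod_ofFn_telescope q]
    · have h1 : q (n + 1) = p (n + 2) := if_neg (by omega)
      have h0 : q 0 = p 0 := if_pos (by omega)
      rw [h1, h0, hp0, inv_one, mul_one]
    · intro i
      have hi := i.isLt
      simp only [faceDegree, hcond]
      by_cases h : i.val + 1 = j.val
      · have hv : (j.succAbove i).val = i.val := by rw [val_succAbove, if_pos (by omega)]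
        have hq : q i.val = p i.val := if_pos (by omega)
        have hq' : q (i.val + 1) = p (i.val + 2) := if_neg (by omega)
        rw [if_pos (Or.inl h), hp, hp, hv, hq, hq', ← h]
        group
      · rw [if_neg (by omega), hp]
        by_cases h' : i.val < j.val
        · have hv : (j.succAbove i).val = i.val := by rw [val_succAbove, if_pos h']
          have hq : q i.val = p i.val := if_pos h'
          have hq' : q (i.val + 1) = p (i.val + 1) := if_pos (by omega)
          rw [hv, hq, hq']
        · have hv : (j.succAbove i).val = i.val + 1 := by rw [val_succAbove, if_neg h']
          have hq : q i.val = p (i.val + 1) := if_neg h'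
          have hq' : q (i.val + 1) = p (i.val + 2) := if_neg (by omega)
          rw [hv, hq, hq']

end Degrees

namespace Grading
variable {k G B : Type u} [Field k] [Group G] [Category.{u} B] [Preadditive B] [Linear k B]
  (gr : Grading k G B)

theorem comp_eqToHom_mem {s : G} {x y z : B} {f : x ⟶ y} (hf : f ∈ gr.deg s x y) (h : y = z) :
    f ≫ eqToHom h ∈ gr.deg s x z := by
  subst h; simpa using hf

theorem eqToHom_comp_mem {s : G} {x y z : B} {f : y ⟶ z} (hf : f ∈ gr.deg s y z) (h : x = y) :
    eqToHom h ≫ f ∈ gr.deg s x z := by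
  subst h; simpa using hf

theorem face_mem {n : ℕ} (j : Fin (n + 2)) {x : Fin (n + 2) → B} {f : ∀ i, x i ⟶ x (i + 1)}
    {s : Fin (n + 2) → G} (hf : ∀ i, f i ∈ gr.deg (s i) (x i) (x (i + 1))) (i : Fin (n + 1)) :
    face j f i ∈ gr.deg (faceDegree j s i) (x (j.succAbove i)) (x (j.succAbove (i + 1))) := by
  by_cases h : j.succAbove i + 1 = j
  · rw [face, dif_pos h, faceDegree, if_pos h]
    exact gr.comp_mem (hf _) (gr.eqToHom_comp_mem (gr.comp_eqToHom_mem (hf _) _) _)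
  · rw [face, dif_neg h, faceDegree, if_neg h]
    exact gr.comp_eqToHom_mem (hf _) _

/-- `C^D_n(B)`: the span of the `f_n ⊗ ... ⊗ f_0` with `f_i` homogeneous of degree `s_i` such that
`s_n ... s_1 s_0` belongs to the conjugacy class `D`. -/
def conjChains (D : ConjClasses G) (n : ℕ) : Submodule k (Chains k B n) :=
  Submodule.span k {c | ∃ (x : Fin (n + 1) → B) (f : ∀ i, x i ⟶ x (i + 1)) (s : Fin (n + 1) → G),
    (∀ i, f i ∈ gr.deg (s i) (x i) (x (i + 1))) ∧ ConjClasses.mk (totalDegree s) = D ∧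
      c = elem k f}

theorem boundary_mem_conjChains (D : ConjClasses G) (n : ℕ) :
    ∀ c ∈ gr.conjChains D (n + 1), boundary k B n c ∈ gr.conjChains D n := by
  change gr.conjChains D (n + 1) ≤ (gr.conjChains D n).comap (boundary k B n)
  refine Submodule.span_le.mpr ?_
  rintro _ ⟨x, f, s, hf, hs, rfl⟩
  simp only [SetLike.mem_coe, Submodule.mem_comap, boundary, LinearMap.sum_apply,
    LinearMap.smul_apply, faceLinear_elem]
  refine Submodule.sum_mem _ fun j _ => Submodule.smul_mem _ _ (Submodule.subset_span ?_)
  refine ⟨_, _, faceDegree j s, gr.face_mem j hf, ?_, rfl⟩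
  rw [← hs]
  exact ConjClasses.mk_eq_mk_iff_isConj.mpr (isConj_totalDegree j s)

/-- The subcomplex `C^D(B)` of the Hochschild-Mitchell complex of a graded category. -/
def conjChainComplex (D : ConjClasses G) : ChainComplex (ModuleCat.{u} k) ℕ :=
  ChainComplex.of (fun n => ModuleCat.of k (gr.conjChains D n))
    (fun n => ModuleCat.ofHom
      ((boundary k B n).restrict (gr.boundary_mem_conjChains D n))) (fun n => by
      refine ModuleCat.hom_ext (LinearMap.ext fun v => Subtype.ext ?_)
      exact (congrArg (fun φ => φ v.1) (boundary_comp_boundary k B n)))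

/-- The component `HH^D_n(B)` of the Hochschild-Mitchell homology of a graded category. -/
def conjHomology (D : ConjClasses G) (n : ℕ) : ModuleCat.{u} k :=
  (gr.conjChainComplex D).homology n

end Grading

/-! ### The quotient category of a free action -/

section Quotient
open MulAction GKCategory

theorem lof_congr {k I : Type u} [Field k] [DecidableEq I] {V : I → Type u}
    [∀ i, AddCommGroup (V i)] [∀ i, Module k (V i)]
    {i j : I} {v : V i} {w : V j} (h : i = j) (h' : HEq v w) : lof k I V i v = lof k I V j w := by
  subst h; rw [eq_of_heq h']

theorem comp_heq_comp {C : Type u} [Category.{u} C] {x y z x' y' z' : C} (hx : x = x')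
    (hy : y = y') (hz : z = z') {f : x ⟶ y} {g : y ⟶ z} {f' : x' ⟶ y'} {g' : y' ⟶ z'}
    (hf : HEq f f') (hg : HEq g g') : HEq (f ≫ g) (f' ≫ g') := by
  subst hx hy hz
  rw [eq_of_heq hf, eq_of_heq hg]

theorem eqToHom_heq_eqToHom {C : Type u} [Category.{u} C] {x y z : C} (hxy : x = y)
    (hx : x = z) (hy : y = z) : HEq (eqToHom hx) (eqToHom hy) := by
  subst hxy; rfl

namespace Orbit

section Shift
variable {G C : Type u} [Group G] [MulAction G C] {α : orbitRel.Quotient G C}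

theorem exists_smul_eq (x y : α.orbit) : ∃ s : G, s • x = y := by
  have hx := orbitRel.Quotient.mem_orbit.mp x.2
  have hy := orbitRel.Quotient.mem_orbit.mp y.2
  obtain ⟨s, hs⟩ := Quotient.eq''.mp (hy.trans hx.symm)
  exact ⟨s, Subtype.ext hs⟩

/-- An element of `G` that moves `x` to `y`, in a given orbit; it is unique if the action is free. -/
def shift (x y : α.orbit) : G := (exists_smul_eq x y).choose

theorem shift_smul (x y : α.orbit) : shift x y • x = y := (exists_smul_eq x y).choose_spec

theorem shift_eq [IsCancelSMul G C] {x y : α.orbit} {s : G} (h : s • x = y) : shift x y = s :=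
  IsCancelSMul.right_cancel _ _ x.1 (congrArg Subtype.val ((shift_smul x y).trans h.symm))

end Shift

variable (k : Type u) {G C : Type u} [Field k] [Group G] [Category.{u} C] [Preadditive C]
  [Linear k C] [MulAction G C] [GKCategory k G C] {α β γ δ : orbitRel.Quotient G C}

/-- The action on morphisms between objects of given orbits. -/
def act (s : G) {x : α.orbit} {y : β.orbit} : (x.1 ⟶ y.1) →ₗ[k] ((s • x).1 ⟶ (s • y).1) :=
  GKCategory.act (k := k) s

theorem act_id (s : G) (x : α.orbit) : act k s (x := x) (y := x) (𝟙 x.1) = 𝟙 (s • x).1 :=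
  GKCategory.act_id s x.1

theorem act_comp (s : G) {x : α.orbit} {y : β.orbit} {z : γ.orbit} (f : x.1 ⟶ y.1)
    (g : y.1 ⟶ z.1) : act k s (x := x) (y := z) (f ≫ g) = act k s f ≫ act k s g :=
  GKCategory.act_comp s f g

theorem act_eqToHom (s : G) {x y : α.orbit} (h : x = y) :
    act k s (x := x) (y := y) (eqToHom (congrArg Subtype.val h)) =
      eqToHom (congrArg (fun x => (s • x).1) h) := by
  subst h; exact act_id k s x

theorem act_one_heq {x : α.orbit} {y : β.orbit} (f : x.1 ⟶ y.1) : HEq (act k (1 : G) f) f := by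
  change HEq (GKCategory.act (k := k) (1 : G) f) f
  rw [GKCategory.act_one]
  exact eqToHom_heq _ _ _

theorem act_mul_heq (s t : G) {x : α.orbit} {y : β.orbit} (f : x.1 ⟶ y.1) :
    HEq (act k (s * t) f) (act k s (act k t f)) := by
  change HEq (GKCategory.act (k := k) (s * t) f)
    (GKCategory.act (k := k) s (GKCategory.act (k := k) t f))
  rw [GKCategory.act_mul]
  exact eqToHom_heq _ _ _

theorem act_heq_of_eq {s t : G} (h : s = t) {x : α.orbit} {y : β.orbit} (f : x.1 ⟶ y.1) :
    HEq (act k s f) (act k t f) := by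
  rw [h]

open Classical in
/-- The action of `G` on the direct sum of the `Hom (x, y)` with `x ∈ α` and `y ∈ β`. -/
def homRep (α β : orbitRel.Quotient G C) :
    Representation k G (⨁ p : α.orbit × β.orbit, (p.1.1 ⟶ p.2.1)) :=
  permRep (I := α.orbit × β.orbit) (V := fun p => (p.1.1 ⟶ p.2.1))
    (fun s p => act k s (x := p.1) (y := p.2))
    (fun p => LinearMap.ext fun f => lof_congr (one_smul G p) (act_one_heq k f))
    (fun s t p => LinearMap.ext fun f => lof_congr (k := k) (mul_smul s t p) (act_mul_heq k s t f))

open Classical in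
theorem homRep_lof (s : G) (p : α.orbit × β.orbit) (f : p.1.1 ⟶ p.2.1) :
    homRep k α β s (lof k _ (fun p : α.orbit × β.orbit => (p.1.1 ⟶ p.2.1)) p f) =
      lof k _ (fun p : α.orbit × β.orbit => (p.1.1 ⟶ p.2.1)) (s • p)
        (act k s (x := p.1) (y := p.2) f) := by
  rw [homRep, permRep_lof]

/-- The morphisms of the quotient category: the coinvariants of `⨁ Hom (x, y)`, `x ∈ α`, `y ∈ β`. -/
abbrev Hom (α β : orbitRel.Quotient G C) : Type u := (homRep k α β).Coinvariants

open Classical in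
/-- The class of `f : x ⟶ y` in the morphisms of the quotient category. -/
def cls (x : α.orbit) (y : β.orbit) : (x.1 ⟶ y.1) →ₗ[k] Hom k α β :=
  Representation.Coinvariants.mk (homRep k α β) ∘ₗ
    lof k (α.orbit × β.orbit) (fun p => (p.1.1 ⟶ p.2.1)) (x, y)

variable {k} in
theorem cls_congr {x x' : α.orbit} {y y' : β.orbit} (hx : x = x') (hy : y = y')
    {f : x.1 ⟶ y.1} {f' : x'.1 ⟶ y'.1} (h : HEq f f') : cls k x y f = cls k x' y' f' := by
  subst hx hy; rw [eq_of_heq h]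

theorem cls_act (s : G) (x : α.orbit) (y : β.orbit) (f : x.1 ⟶ y.1) :
    cls k (s • x) (s • y) (act k s f) = cls k x y f := by
  classical
  have := Representation.Coinvariants.mk_self_apply (homRep k α β) s
    (lof k (α.orbit × β.orbit) (fun p => (p.1.1 ⟶ p.2.1)) (x, y) f)
  rw [homRep_lof] at this
  exact this

variable {k} in
theorem hom_induction {motive : Hom k α β → Prop} (φ : Hom k α β)
    (zero : motive 0) (add : ∀ φ ψ, motive φ → motive ψ → motive (φ + ψ))
    (of_cls : ∀ (x : α.orbit) (y : β.orbit) (f : x.1 ⟶ y.1), motive (cls k x y f)) :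
    motive φ := by
  classical
  refine Representation.Coinvariants.induction_on (motive := motive) φ fun v => ?_
  induction v using DirectSum.induction_on with
  | zero => rw [map_zero]; exact zero
  | of p f => exact of_cls p.1 p.2 f
  | add v w hv hw => rw [map_add]; exact add _ _ hv hw

theorem cls_eqToHom_comp {x x' : α.orbit} (h : x = x') (y : β.orbit) (f : x'.1 ⟶ y.1) :
    cls k x y (eqToHom (congrArg Subtype.val h) ≫ f) = cls k x' y f := by
  subst h
  simp

theorem cls_comp_eqToHom (x : α.orbit) {y y' : β.orbit} (h : y = y') (f : x.1 ⟶ y.1) :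
    cls k x y' (f ≫ eqToHom (congrArg Subtype.val h)) = cls k x y f := by
  subst h
  simp

/-- Composition on representatives: for `f : x ⟶ y` and `g : y' ⟶ z` with `y` and `y'` in the same
orbit, the class of `g ∘ (s f)`, where `s • y = y'`. -/
def compGen (p : α.orbit × β.orbit) (q : β.orbit × γ.orbit) :
    (p.1.1 ⟶ p.2.1) →ₗ[k] (q.1.1 ⟶ q.2.1) →ₗ[k] Hom k α γ :=
  LinearMap.mk₂ k
    (fun f g => cls k (shift p.2 q.1 • p.1) q.2 (act k (shift p.2 q.1) f ≫
      eqToHom (congrArg Subtype.val (shift_smul p.2 q.1)) ≫ g))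
    (fun f f' g => by rw [map_add, Preadditive.add_comp, map_add])
    (fun c f g => by rw [map_smul, Linear.smul_comp, map_smul])
    (fun f g g' => by rw [Preadditive.comp_add, Preadditive.comp_add, map_add])
    (fun c f g => by rw [Linear.comp_smul, Linear.comp_smul, map_smul])

open Classical in
/-- Composition on the direct sums, extended bilinearly from representatives. -/
def compSum (α β γ : orbitRel.Quotient G C) :
    (⨁ p : α.orbit × β.orbit, (p.1.1 ⟶ p.2.1)) →ₗ[k]
      (⨁ q : β.orbit × γ.orbit, (q.1.1 ⟶ q.2.1)) →ₗ[k] Hom k α γ :=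
  toModule k _ _ fun p => (toModule k _ _ fun q => (compGen k p q).flip).flip

open Classical in
theorem compSum_lof (p : α.orbit × β.orbit) (q : β.orbit × γ.orbit) (f : p.1.1 ⟶ p.2.1)
    (g : q.1.1 ⟶ q.2.1) :
    compSum k α β γ (lof k _ (fun p : α.orbit × β.orbit => (p.1.1 ⟶ p.2.1)) p f)
      (lof k _ (fun q : β.orbit × γ.orbit => (q.1.1 ⟶ q.2.1)) q g) = compGen k p q f g := by
  rw [compSum, toModule_lof, LinearMap.flip_apply, toModule_lof, LinearMap.flip_apply]

theorem exists_cls_source (y : β.orbit) (y' : β.orbit) (z : γ.orbit) (g : y'.1 ⟶ z.1) :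
    ∃ (z' : γ.orbit) (g' : y.1 ⟶ z'.1), cls k y' z g = cls k y z' g' := by
  obtain ⟨s, rfl⟩ := exists_smul_eq y' y
  exact ⟨s • z, act k s g, (cls_act k s _ _ _).symm⟩

theorem exists_cls_target (y' : β.orbit) (y : β.orbit) (x : α.orbit) (f : x.1 ⟶ y'.1) :
    ∃ (x' : α.orbit) (f' : x'.1 ⟶ y.1), cls k x y' f = cls k x' y f' := by
  obtain ⟨s, rfl⟩ := exists_smul_eq y' y
  exact ⟨s • x, act k s f, (cls_act k s _ _ _).symm⟩

/-- An object of a given orbit. -/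
def base (α : orbitRel.Quotient G C) : α.orbit :=
  ⟨α.out, orbitRel.Quotient.mem_orbit.mpr α.out_eq'⟩

/-- The class of the identity of any object of the orbit. -/
def idHom (α : orbitRel.Quotient G C) : Hom k α α := cls k (base α) (base α) (𝟙 _)

theorem idHom_eq (x : α.orbit) : idHom k α = cls k x x (𝟙 x.1) := by
  obtain ⟨s, rfl⟩ := exists_smul_eq (base α) x
  rw [idHom, ← cls_act k s, act_id]

variable [IsCancelSMul G C]

theorem compGen_apply (p : α.orbit × β.orbit) (q : β.orbit × γ.orbit) (s : G) (h : s • p.2 = q.1)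
    (f : p.1.1 ⟶ p.2.1) (g : q.1.1 ⟶ q.2.1) :
    compGen k p q f g = cls k (s • p.1) q.2 (act k s f ≫
      eqToHom (congrArg Subtype.val h) ≫ g) := by
  obtain rfl := shift_eq h
  rfl

theorem compGen_act_left (s : G) (p : α.orbit × β.orbit) (q : β.orbit × γ.orbit)
    (f : p.1.1 ⟶ p.2.1) (g : q.1.1 ⟶ q.2.1) :
    compGen k (s • p) q (act k s f) g = compGen k p q f g := by
  have h := shift_smul p.2 q.1
  have h' : (shift p.2 q.1 * s⁻¹) • (s • p).2 = q.1 := by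
    rw [Prod.smul_snd, smul_smul]; simpa using h
  have e : shift p.2 q.1 * s⁻¹ * s = shift p.2 q.1 := by simp
  have hx : ∀ {ε : orbitRel.Quotient G C} (x : ε.orbit),
      (shift p.2 q.1 * s⁻¹) • s • x = shift p.2 q.1 • x := fun x => by rw [smul_smul, e]
  refine (compGen_apply k (s • p) q _ h' _ _).trans (Eq.trans ?_ (compGen_apply k p q _ h _ _).symm)
  refine cls_congr (hx p.1) rfl (comp_heq_comp (congrArg Subtype.val (hx p.1))
    (congrArg Subtype.val (hx p.2)) rfl ?_ ?_)
  · exact (act_mul_heq k _ s f).symm.trans (act_heq_of_eq k e f)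
  · exact comp_heq_comp (congrArg Subtype.val (hx p.2)) rfl rfl
      (eqToHom_heq_eqToHom (congrArg Subtype.val (hx p.2)) _ _) HEq.rfl

theorem compGen_act_right (s : G) (p : α.orbit × β.orbit) (q : β.orbit × γ.orbit)
    (f : p.1.1 ⟶ p.2.1) (g : q.1.1 ⟶ q.2.1) :
    compGen k p (s • q) f (act k s g) = compGen k p q f g := by
  have h := shift_smul p.2 q.1
  have h' : (s * shift p.2 q.1) • p.2 = (s • q).1 := by
    rw [mul_smul, h]; rfl
  have hx : ∀ {ε : orbitRel.Quotient G C} (x : ε.orbit),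
      (s * shift p.2 q.1) • x = s • shift p.2 q.1 • x := fun x => mul_smul _ _ _
  rw [compGen_apply k p q _ h, ← cls_act k s]
  refine (compGen_apply k p (s • q) _ h' _ _).trans ?_
  rw [act_comp k s (y := shift p.2 q.1 • p.2), act_comp k s (y := q.1), act_eqToHom k s h]
  exact cls_congr (hx p.1) rfl (comp_heq_comp (congrArg Subtype.val (hx p.1))
    (congrArg Subtype.val (hx p.2)) rfl (act_mul_heq k _ _ f)
    (comp_heq_comp (congrArg Subtype.val (hx p.2)) rfl rfl
      (eqToHom_heq_eqToHom (congrArg Subtype.val (hx p.2)) _ _) HEq.rfl))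

theorem compSum_comp_left (s : G) :
    compSum k α β γ ∘ₗ homRep k α β s = compSum k α β γ := by
  classical
  refine linearMap_ext k fun p => LinearMap.ext fun f =>
    linearMap_ext k fun q => LinearMap.ext fun g => ?_
  simp only [LinearMap.comp_apply, homRep_lof, compSum_lof]
  exact compGen_act_left k s p q f g

theorem compSum_right (s : G) (v : ⨁ p : α.orbit × β.orbit, (p.1.1 ⟶ p.2.1)) :
    compSum k α β γ v ∘ₗ homRep k β γ s = compSum k α β γ v := by
  classical
  induction v using DirectSum.induction_on with
  | zero => rw [map_zero, LinearMap.zero_comp]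
  | of p f =>
    refine linearMap_ext k fun q => LinearMap.ext fun g => ?_
    change compSum k α β γ (lof k _ (fun p : α.orbit × β.orbit => (p.1.1 ⟶ p.2.1)) p f) _ =
      compSum k α β γ (lof k _ (fun p : α.orbit × β.orbit => (p.1.1 ⟶ p.2.1)) p f) _
    rw [homRep_lof, compSum_lof, compSum_lof]
    exact compGen_act_right k s p q f g
  | add v w hv hw => rw [map_add, LinearMap.add_comp, hv, hw]

/-- Composition of the quotient category, on coinvariants. -/
def compHom (α β γ : orbitRel.Quotient G C) : Hom k α β →ₗ[k] Hom k β γ →ₗ[k] Hom k α γ :=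
  (Representation.Coinvariants.lift (homRep k β γ)
    (Representation.Coinvariants.lift (homRep k α β) (compSum k α β γ)
      (compSum_comp_left k)).flip (fun s => by
        refine LinearMap.ext fun w => LinearMap.ext fun φ => ?_
        induction φ using Representation.Coinvariants.induction_on with
        | h v => exact congrArg (fun ψ => ψ w) (compSum_right k s v))).flip

theorem compHom_cls (x : α.orbit) (y y' : β.orbit) (z : γ.orbit) (s : G) (h : s • y = y')
    (f : x.1 ⟶ y.1) (g : y'.1 ⟶ z.1) :
    compHom k α β γ (cls k x y f) (cls k y' z g) =
      cls k (s • x) z (act k s f ≫ eqToHom (congrArg Subtype.val h) ≫ g) := by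
  classical
  exact (compSum_lof k (x, y) (y', z) f g).trans (compGen_apply k (x, y) (y', z) s h f g)

theorem compHom_cls_cls (x : α.orbit) (y : β.orbit) (z : γ.orbit) (f : x.1 ⟶ y.1)
    (g : y.1 ⟶ z.1) :
    compHom k α β γ (cls k x y f) (cls k y z g) = cls k x z (f ≫ g) := by
  rw [compHom_cls k x y y z 1 (one_smul G y)]
  refine cls_congr (one_smul G x) rfl (comp_heq_comp (congrArg Subtype.val (one_smul G x))
    (congrArg Subtype.val (one_smul G y)) rfl (act_one_heq k f) ?_)
  simpa using eqToHom_heq (congrArg Subtype.val (one_smul G y)) rfl g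

theorem id_compHom (f : Hom k α β) : compHom k α α β (idHom k α) f = f := by
  induction f using hom_induction with
  | zero => rw [map_zero]
  | add f g hf hg => rw [map_add, hf, hg]
  | of_cls x y f => rw [idHom_eq k x, compHom_cls_cls, Category.id_comp]

theorem compHom_id (f : Hom k α β) : compHom k α β β f (idHom k β) = f := by
  induction f using hom_induction with
  | zero => rw [map_zero, LinearMap.zero_apply]
  | add f g hf hg => rw [map_add, LinearMap.add_apply, hf, hg]
  | of_cls x y f => rw [idHom_eq k y, compHom_cls_cls, Category.comp_id]

theorem compHom_assoc (f : Hom k α β) (g : Hom k β γ) (h : Hom k γ δ) :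
    compHom k α γ δ (compHom k α β γ f g) h = compHom k α β δ f (compHom k β γ δ g h) := by
  induction g using hom_induction with
  | zero => simp only [map_zero, LinearMap.zero_apply]
  | add g g' hg hg' => simp only [map_add, LinearMap.add_apply, hg, hg']
  | of_cls y z g =>
    induction f using hom_induction with
    | zero => simp only [map_zero, LinearMap.zero_apply]
    | add f f' hf hf' => simp only [map_add, LinearMap.add_apply, hf, hf']
    | of_cls x y' f =>
      induction h using hom_induction with
      | zero => simp only [map_zero]
      | add h h' hh hh' => simp only [map_add, hh, hh']
      | of_cls z' w h =>
        obtain ⟨x', f', e1⟩ := exists_cls_target k y' y x f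
        obtain ⟨w', h', e2⟩ := exists_cls_source k z z' w h
        rw [e1, e2, compHom_cls_cls, compHom_cls_cls, compHom_cls_cls, compHom_cls_cls,
          Category.assoc]

theorem add_compHom (f f' : Hom k α β) (g : Hom k β γ) :
    compHom k α β γ (f + f') g = compHom k α β γ f g + compHom k α β γ f' g := by
  rw [map_add, LinearMap.add_apply]

theorem compHom_add (f : Hom k α β) (g g' : Hom k β γ) :
    compHom k α β γ f (g + g') = compHom k α β γ f g + compHom k α β γ f g' := by
  rw [map_add]

theorem smul_compHom (c : k) (f : Hom k α β) (g : Hom k β γ) :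
    compHom k α β γ (c • f) g = c • compHom k α β γ f g := by
  rw [map_smul, LinearMap.smul_apply]

theorem compHom_smul (c : k) (f : Hom k α β) (g : Hom k β γ) :
    compHom k α β γ f (c • g) = c • compHom k α β γ f g := by
  rw [map_smul]

end Orbit

/-- The quotient category `C/G` of a free action. Its objects are the orbits of the action on
the objects of `C`; the parameter `k` only serves to find the structure of `k`-category. -/
def OrbitCategory (_k G C : Type u) [Group G] [MulAction G C] : Type u := orbitRel.Quotient G C

section Category
variable (k G C : Type u) [Field k] [Group G] [Category.{u} C] [Preadditive C]
  [Linear k C] [MulAction G C] [GKCategory k G C] [IsCancelSMul G C]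

instance : Category.{u} (OrbitCategory k G C) where
  Hom α β := Orbit.Hom k (G := G) (C := C) α β
  id α := Orbit.idHom k (G := G) (C := C) α
  comp {α β γ} f g := Orbit.compHom k (G := G) (C := C) α β γ f g
  id_comp f := Orbit.id_compHom k f
  comp_id f := Orbit.compHom_id k f
  assoc f g h := Orbit.compHom_assoc k f g h

instance (α β : OrbitCategory k G C) : AddCommGroup (α ⟶ β) :=
  (inferInstance : AddCommGroup (Orbit.homRep k (G := G) (C := C) α β).Coinvariants)

instance (α β : OrbitCategory k G C) : Module k (α ⟶ β) :=
  (inferInstance : Module k (Orbit.homRep k (G := G) (C := C) α β).Coinvariants)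

theorem OrbitCategory.add_comp {α β γ : OrbitCategory k G C} (f f' : α ⟶ β) (g : β ⟶ γ) :
    (f + f') ≫ g = f ≫ g + f' ≫ g :=
  Orbit.add_compHom k (G := G) (C := C) (α := α) (β := β) (γ := γ) f f' g

theorem OrbitCategory.comp_add {α β γ : OrbitCategory k G C} (f : α ⟶ β) (g g' : β ⟶ γ) :
    f ≫ (g + g') = f ≫ g + f ≫ g' :=
  Orbit.compHom_add k (G := G) (C := C) (α := α) (β := β) (γ := γ) f g g'

instance : Preadditive (OrbitCategory k G C) where
  homGroup := inferInstance
  add_comp _ _ _ f f' g := OrbitCategory.add_comp k G C f f' g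
  comp_add _ _ _ f g g' := OrbitCategory.comp_add k G C f g g'

instance : Linear k (OrbitCategory k G C) where
  homModule := inferInstance
  smul_comp α β γ c f g :=
    Orbit.smul_compHom k (G := G) (C := C) (α := α) (β := β) (γ := γ) c f g
  comp_smul α β γ f c g :=
    Orbit.compHom_smul k (G := G) (C := C) (α := α) (β := β) (γ := γ) c f g

/-- The Galois covering `C → C/G`: the canonical projection functor. -/
def galoisCovering : C ⥤ OrbitCategory k G C where
  obj x := (Quotient.mk'' x : orbitRel.Quotient G C)
  map {x y} f := Orbit.cls k (α := (Quotient.mk'' x : orbitRel.Quotient G C))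
    (β := (Quotient.mk'' y : orbitRel.Quotient G C)) ⟨x, orbitRel.Quotient.mem_orbit.mpr rfl⟩
    ⟨y, orbitRel.Quotient.mem_orbit.mpr rfl⟩ f
  map_id x := (Orbit.idHom_eq k (α := (Quotient.mk'' x : orbitRel.Quotient G C))
    ⟨x, orbitRel.Quotient.mem_orbit.mpr rfl⟩).symm
  map_comp {x y z} f g := (Orbit.compHom_cls_cls k
    (α := (Quotient.mk'' x : orbitRel.Quotient G C))
    (β := (Quotient.mk'' y : orbitRel.Quotient G C))
    (γ := (Quotient.mk'' z : orbitRel.Quotient G C)) ⟨x, orbitRel.Quotient.mem_orbit.mpr rfl⟩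
    ⟨y, orbitRel.Quotient.mem_orbit.mpr rfl⟩ ⟨z, orbitRel.Quotient.mem_orbit.mpr rfl⟩ f g).symm

end Category
end Quotient

/-! ### The grading of the quotient category given by a transversal -/

section QuotientGrading
open MulAction

namespace Orbit
variable (k : Type u) {G C : Type u} [Field k] [Group G] [Category.{u} C] [Preadditive C]
  [Linear k C] [MulAction G C] [GKCategory k G C] (r : ∀ α : orbitRel.Quotient G C, α.orbit)

/-- The morphisms of degree `s` from `α` to `β`, for a choice `r α ∈ α` of representatives: the
image of `Hom (s • r α, r β)`. -/
def deg (s : G) (α β : orbitRel.Quotient G C) : Submodule k (Hom k α β) :=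
  LinearMap.range (cls k (s • r α) (r β))

variable [IsCancelSMul G C]

theorem compHom_mem_deg {s t : G} {α β γ : orbitRel.Quotient G C} {f : Hom k α β}
    {g : Hom k β γ} (hf : f ∈ deg k r s α β) (hg : g ∈ deg k r t β γ) :
    compHom k α β γ f g ∈ deg k r (t * s) α γ := by
  obtain ⟨f, rfl⟩ := hf
  obtain ⟨g, rfl⟩ := hg
  rw [compHom_cls k (s • r α) (r β) (t • r β) (r γ) t rfl, deg, mul_smul]
  exact ⟨_, rfl⟩

variable (α β : orbitRel.Quotient G C)

open Classical in
/-- The map from the direct sum of the `Hom (s • r α, r β)` to the morphisms from `α` to `β`. -/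
def ofDeg : (⨁ s : G, ((s • r α).1 ⟶ (r β).1)) →ₗ[k] Hom k α β :=
  toModule k G _ fun s => cls k (s • r α) (r β)

open Classical in
/-- The inverse of `ofDeg` on representatives. -/
def toDegGen (p : α.orbit × β.orbit) :
    (p.1.1 ⟶ p.2.1) →ₗ[k] (⨁ s : G, ((s • r α).1 ⟶ (r β).1)) :=
  lof k G (fun s => ((s • r α).1 ⟶ (r β).1)) (shift (r α) (shift p.2 (r β) • p.1)) ∘ₗ
    Linear.leftComp k _ (eqToHom (congrArg Subtype.val (shift_smul _ _))) ∘ₗ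
    Linear.rightComp k _ (eqToHom (congrArg Subtype.val (shift_smul _ _))) ∘ₗ
    act k (shift p.2 (r β))

variable {α β} in
open Classical in
theorem toDegGen_apply (p : α.orbit × β.orbit) (t s : G) (ht : t • p.2 = r β)
    (hs : s • r α = t • p.1) (f : p.1.1 ⟶ p.2.1) (w : (s • r α).1 ⟶ (r β).1)
    (hw : HEq (act k t f) w) :
    toDegGen k r α β p f = lof k G (fun s => ((s • r α).1 ⟶ (r β).1)) s w := by
  obtain rfl := shift_eq ht
  obtain rfl := shift_eq hs
  exact lof_congr rfl ((eqToHom_heq _ _ _).trans hw)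

open Classical in
/-- The inverse of `ofDeg`. -/
def toDeg : Hom k α β →ₗ[k] (⨁ s : G, ((s • r α).1 ⟶ (r β).1)) :=
  Representation.Coinvariants.lift (homRep k α β) (toModule k _ _ (toDegGen k r α β))
    (fun s => linearMap_ext k fun p => LinearMap.ext fun f => by
      simp only [LinearMap.comp_apply, homRep_lof, toModule_lof]
      have h1 := shift_smul p.2 (r β)
      have h2 := shift_smul (r α) (shift p.2 (r β) • p.1)
      have e : shift p.2 (r β) * s⁻¹ * s = shift p.2 (r β) := by simp
      refine toDegGen_apply k r (s • p) (shift p.2 (r β) * s⁻¹)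
        (shift (r α) (shift p.2 (r β) • p.1)) ?_ ?_ _ _ ?_
      · rw [Prod.smul_snd, smul_smul, e, h1]
      · rw [Prod.smul_fst, smul_smul, e, h2]
      · refine (act_mul_heq k _ s f).symm.trans ((act_heq_of_eq k e f).trans ?_)
        exact (eqToHom_heq _ _ _).symm)

variable {α β} in
theorem toDeg_cls (x : α.orbit) (y : β.orbit) (f : x.1 ⟶ y.1) :
    toDeg k r α β (cls k x y f) = toDegGen k r α β (x, y) f := by
  classical
  exact (toModule_lof ..)

theorem ofDeg_toDeg (φ : Hom k α β) : ofDeg k r α β (toDeg k r α β φ) = φ := by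
  classical
  induction φ using hom_induction with
  | zero => rw [map_zero, map_zero]
  | add f g hf hg => rw [map_add, map_add, hf, hg]
  | of_cls x y f =>
    have h1 := shift_smul y (r β)
    have h2 := shift_smul (r α) (shift y (r β) • x)
    rw [toDeg_cls, toDegGen]
    simp only [LinearMap.comp_apply]
    rw [ofDeg, toModule_lof, ← cls_act k (shift y (r β)) x y f]
    exact cls_congr h2 h1.symm (eqToHom_heq _ _ _)

theorem toDeg_ofDeg (v : ⨁ s : G, ((s • r α).1 ⟶ (r β).1)) :
    toDeg k r α β (ofDeg k r α β v) = v := by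
  classical
  refine LinearMap.congr_fun (f := toDeg k r α β ∘ₗ ofDeg k r α β) (g := LinearMap.id) ?_ v
  refine linearMap_ext k fun s => LinearMap.ext fun f => ?_
  simp only [LinearMap.comp_apply, ofDeg, toModule_lof, toDeg_cls, LinearMap.id_apply]
  exact toDegGen_apply k r (s • r α, r β) 1 s (one_smul _ _) (one_smul _ _).symm f f
    (act_one_heq k f)

/-- The map from `Hom (s • r α, r β)` onto the morphisms of degree `s`. -/
def toPiece (s : G) : ((s • r α).1 ⟶ (r β).1) →ₗ[k] deg k r s α β :=
  (cls k (s • r α) (r β)).rangeRestrict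

open Classical in
theorem isInternal_deg : DirectSum.IsInternal fun s => deg k r s α β := by
  have hR : (DirectSum.coeLinearMap fun s => deg k r s α β) ∘ₗ
      DirectSum.lmap (toPiece k r α β) = ofDeg k r α β := by
    refine linearMap_ext k fun s => LinearMap.ext fun f => ?_
    rw [LinearMap.comp_apply, LinearMap.comp_apply, LinearMap.comp_apply, DirectSum.lmap_lof,
      DirectSum.coeLinearMap_lof, ofDeg, toModule_lof]
    rfl
  have hs : Function.Surjective (DirectSum.lmap (toPiece k r α β)) :=
    (DirectSum.lmap_surjective _).mpr fun s => LinearMap.surjective_rangeRestrict _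
  constructor
  · intro a b hab
    obtain ⟨v, rfl⟩ := hs a
    obtain ⟨w, rfl⟩ := hs b
    have : ofDeg k r α β v = ofDeg k r α β w :=
      (LinearMap.congr_fun hR v).symm.trans (Eq.trans hab (LinearMap.congr_fun hR w))
    rw [← toDeg_ofDeg k r α β v, this, toDeg_ofDeg]
  · intro φ
    exact ⟨_, (LinearMap.congr_fun hR (toDeg k r α β φ)).trans (ofDeg_toDeg k r α β φ)⟩

end Orbit

/-- `T` contains exactly one element of each orbit. -/
def IsTransversal (G : Type u) {C : Type u} [Group G] [MulAction G C] (T : Set C) : Prop :=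
  ∀ α : orbitRel.Quotient G C, ∃! u : C, u ∈ T ∧ u ∈ α.orbit

/-- The element of a transversal in a given orbit. -/
def IsTransversal.rep {G C : Type u} [Group G] [MulAction G C] {T : Set C}
    (hT : IsTransversal G T) (α : orbitRel.Quotient G C) : α.orbit :=
  ⟨(hT α).choose, (hT α).choose_spec.1.2⟩

/-- The grading of `C/G` determined by a transversal: the morphisms of degree `s` from `α` to `β`
are the classes of the morphisms `s • u_α ⟶ u_β`. -/
def orbitGrading (k G C : Type u) [Field k] [Group G] [Category.{u} C] [Preadditive C]
    [Linear k C] [MulAction G C] [GKCategory k G C] [IsCancelSMul G C] {T : Set C}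
    (hT : IsTransversal G T) : Grading k G (OrbitCategory k G C) where
  deg s α β := Orbit.deg k hT.rep s α β
  isInternal α β := Orbit.isInternal_deg k hT.rep α β
  comp_mem hf hg := Orbit.compHom_mem_deg k hT.rep hf hg

end QuotientGrading

end

end HochschildMitchell

namespace HochschildMitchell

open CategoryTheory DirectSum TensorProduct

noncomputable section

/-! ### The map on chains induced by a linear functor -/

section Functoriality

/-! The projection `C ⥤ C/G` already induces the isomorphism on the level of chains. Write `u` for
the chosen representative of an orbit.

Let `f i : x i ⟶ x (i + 1)` be a cyclic string in `C`, and let `p i` move `x i` to the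
representative `u i` of its orbit. Translating `f i` by `p (i + 1)` gives a morphism `s i • u i ⟶ u
(i + 1)` with `s i = p (i + 1) * (p i)⁻¹`. So the image of `f i` in `C/G` is homogeneous of degree
`s i`, and the product of the `s i` telescopes around the cycle to `1`. The induced chain map
therefore lands in the component of trivial degree. It is `G`-invariant, because a morphism and its
translates have the same class, so it factors through the coinvariants (`mapChains_chainsRep`,
`mapChains_mem_conjChains`).

Conversely, for a homogeneous string in `C/G` of degrees `s i`, the equations `p (i + 1) = s i * p
i` are solvable around the cycle exactly when the total degree is `1`. A solution lifts the string
to one in `C` through the objects `(p i)⁻¹ • u i`. Two solutions differ by right multiplication by a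
constant, so the two lifts differ by the action of one group element and agree in the coinvariants
(`mk_liftChain_eq`). Extended linearly, lifting gives a left inverse of the map from the
coinvariants (`liftChains_mapChains`). The image of a lift is the original string, which gives
surjectivity (`mapChains_liftChain`).

The two complexes are thus isomorphic, which is the first claim. The second follows because an exact
functor commutes with homology. -/

theorem map_face {C D : Type u} [Category.{u} C] [Category.{u} D] (F : C ⥤ D)
    {n : ℕ} (j : Fin (n + 2)) {x : Fin (n + 2) → C} (f : ∀ i, x i ⟶ x (i + 1)) (i : Fin (n + 1)) :
    F.map (face j f i) = face (x := fun i => F.obj (x i)) j (fun i => F.map (f i)) i := by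
  simp only [face]
  split_ifs <;> simp [eqToHom_map]

variable (k : Type u) [Field k] {C D : Type u} [Category.{u} C] [Preadditive C] [Linear k C]
  [Category.{u} D] [Preadditive D] [Linear k D] (F : C ⥤ D) [F.Additive] [F.Linear k]

/-- The map `f_n ⊗ ... ⊗ f_0 ↦ F f_n ⊗ ... ⊗ F f_0` on chains induced by a linear functor `F`. -/
def mapChains (n : ℕ) : Chains k C n →ₗ[k] Chains k D n := by
  classical
  exact DirectSum.toModule k _ _ fun x =>
    DirectSum.lof k (Fin (n + 1) → D) (fun x => ⨂[k] i, (x i ⟶ x (i + 1)))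
      (fun i => F.obj (x i)) ∘ₗ PiTensorProduct.map fun i => F.mapLinearMap k

@[simp]
theorem mapChains_elem {n : ℕ} {x : Fin (n + 1) → C} (f : ∀ i, x i ⟶ x (i + 1)) :
    mapChains k F n (elem k f) = elem k (x := fun i => F.obj (x i)) (fun i => F.map (f i)) := by
  classical
  rw [mapChains, elem, elem, DirectSum.toModule_lof, LinearMap.comp_apply,
    PiTensorProduct.map_tprod]
  rfl

theorem boundary_mapChains (n : ℕ) (c : Chains k C (n + 1)) :
    boundary k D n (mapChains k F (n + 1) c) = mapChains k F n (boundary k C n c) := by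
  refine LinearMap.congr_fun (f := boundary k D n ∘ₗ mapChains k F (n + 1))
    (g := mapChains k F n ∘ₗ boundary k C n) (chains_hom_ext fun x f => ?_) c
  simp only [LinearMap.comp_apply, mapChains_elem, boundary, LinearMap.sum_apply, map_sum,
    LinearMap.smul_apply, map_smul, faceLinear_elem, map_face]

end Functoriality

/-! ### Cyclic sequences in a group and the total degree -/

section Cyclic
variable {G : Type u} [Group G]

/-- Each `s i` is `p (i + 1) * (p i)⁻¹`, so the product telescopes, and since indices are cyclic the
last factor cancels the first. -/
theorem totalDegree_eq_one {n : ℕ} {s p : Fin (n + 1) → G} (h : ∀ i, p (i + 1) = s i * p i) :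
    totalDegree s = 1 := by
  -- The telescoping lemma needs a sequence on `ℕ`; `p` is extended periodically, so its value at `n
  -- + 1` is `p 0`.
  rw [totalDegree, prod_ofFn_telescope (fun m => p (Fin.ofNat (n + 1) m))]
  · have : Fin.ofNat (n + 1) (n + 1) = 0 := Fin.ext (Nat.mod_self _)
    rw [this]
    exact mul_inv_cancel _
  · intro i
    have : Fin.ofNat (n + 1) (i.val + 1) = i + 1 := Fin.ext (val_add_one_mod i).symm
    rw [this, Fin.ofNat_val_eq_self, h, mul_inv_cancel_right]

/-- The partial products `s (m - 1) * ... * s 0` solve the recursion at every index except possibly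
the last, where the cycle closes; there the condition is exactly that the total product is `1`. -/
theorem exists_of_totalDegree_eq_one {n : ℕ} {s : Fin (n + 1) → G} (h : totalDegree s = 1) :
    ∃ p : Fin (n + 1) → G, ∀ i, p (i + 1) = s i * p i := by
  let p : ℕ → G := fun m => Nat.rec 1 (fun i a => s (Fin.ofNat (n + 1) i) * a) m
  have hp : ∀ i : Fin (n + 1), p (i.val + 1) = s i * p i.val := fun i => by
    change s (Fin.ofNat (n + 1) i.val) * p i.val = _
    rw [Fin.ofNat_val_eq_self]
  have hlast : p (n + 1) = 1 := by
    rw [totalDegree, prod_ofFn_telescope p _ s fun i => by rw [hp]; group] at h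
    simpa [p] using h
  refine ⟨fun i => p i.val, fun i => ?_⟩
  change p (i + 1).val = s i * p i.val
  rw [← hp, val_add_one']
  split_ifs with hi
  -- The wrap-around index `i = n`: the successor is `0`, and `p 0 = 1` has to agree with `p (n +
  -- 1)`.
  · rw [hi, hlast]
    rfl
  · rfl

/-- Both solutions are multiplied on the left by the same `s i`, which cancels in `(q i)⁻¹ * p i`.
Hence a solution is unique up to right multiplication by a constant. -/
theorem inv_mul_eq_of_cyclic {n : ℕ} {s p q : Fin (n + 1) → G} (hp : ∀ i, p (i + 1) = s i * p i)
    (hq : ∀ i, q (i + 1) = s i * q i) (i : Fin (n + 1)) : (q i)⁻¹ * p i = (q 0)⁻¹ * p 0 := by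
  induction i using Fin.induction with
  | zero => rfl
  | succ i ih =>
    rw [← ih, ← Fin.coeSucc_eq_succ, hp, hq]
    group

end Cyclic

/-! ### Chains of the quotient category -/

section Covering
open MulAction

section
variable (k G C : Type u) [Field k] [Group G] [Category.{u} C] [Preadditive C] [Linear k C]
  [MulAction G C] [GKCategory k G C] [IsCancelSMul G C]

instance : (galoisCovering k G C).Additive where
  map_add {_ _ _ _} := map_add (Orbit.cls k _ _) _ _

instance : (galoisCovering k G C).Linear k where
  map_smul {_ _} f c := map_smul (Orbit.cls k _ _) c f

end

variable (k : Type u) {G C : Type u} [Field k] [Group G] [Category.{u} C] [Preadditive C]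
  [Linear k C] [MulAction G C] [GKCategory k G C]

/-- The endpoints of a translated morphism depend on the group element, so identities between
translates are stated here, and in the lemmas below, as heterogeneous equalities. -/
theorem act_heq_of_eq {s t : G} (h : s = t) {x y : C} (f : x ⟶ y) :
    HEq (GKCategory.act (k := k) s f) (GKCategory.act (k := k) t f) := by
  rw [h]

theorem act_heq_act (s : G) {x y x' y' : C} (hx : x = x') (hy : y = y') {f : x ⟶ y}
    {f' : x' ⟶ y'} (h : HEq f f') :
    HEq (GKCategory.act (k := k) s f) (GKCategory.act (k := k) s f') := by
  subst hx hy
  rw [eq_of_heq h]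

theorem act_mul_heq (s t : G) {x y : C} (f : x ⟶ y) :
    HEq (GKCategory.act (k := k) (s * t) f)
      (GKCategory.act (k := k) s (GKCategory.act (k := k) t f)) := by
  rw [GKCategory.act_mul]
  exact eqToHom_heq _ _ _

theorem act_inv_act_heq (s : G) {x y : C} (f : x ⟶ y) :
    HEq (GKCategory.act (k := k) s⁻¹ (GKCategory.act (k := k) s f)) f := by
  refine (act_mul_heq k _ _ f).symm.trans ((act_heq_of_eq k (inv_mul_cancel s) f).trans ?_)
  rw [GKCategory.act_one]
  exact eqToHom_heq _ _ _

variable [IsCancelSMul G C]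

/-- The covering sends `x` to the orbit built from `x` itself, whereas chains of `C/G` are indexed
by arbitrary names `α` of orbits. This bridges the two. -/
theorem galoisCovering_map_heq {α β : orbitRel.Quotient G C} (x : α.orbit) (y : β.orbit)
    (f : x.1 ⟶ y.1) : HEq ((galoisCovering k G C).map f) (Orbit.cls k x y f) := by
  obtain ⟨x, hx⟩ := x
  obtain ⟨y, hy⟩ := y
  obtain rfl := orbitRel.Quotient.mem_orbit.mp hx
  obtain rfl := orbitRel.Quotient.mem_orbit.mp hy
  rfl

end Covering

/-! ### Lifting homogeneous strings of trivial total degree -/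

section Lift
open MulAction

/-- The orbit of an object. -/
abbrev orbitMk (G : Type u) {C : Type u} [Group G] [MulAction G C] (x : C) :
    orbitRel.Quotient G C := Quotient.mk'' x

/-- An object, as an element of its orbit. -/
def toOrbit (G : Type u) {C : Type u} [Group G] [MulAction G C] (x : C) : (orbitMk G x).orbit :=
  ⟨x, orbitRel.Quotient.mem_orbit.mpr rfl⟩

variable (k : Type u) {G C : Type u} [Field k] [Group G] [Category.{u} C] [Preadditive C]
  [Linear k C] [MulAction G C] [GKCategory k G C] (r : ∀ α : orbitRel.Quotient G C, α.orbit)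
  {n : ℕ} {α : Fin (n + 1) → orbitRel.Quotient G C} {s p : Fin (n + 1) → G}

/-- The lift to `C` of a homogeneous morphism of degree `s i`, where `p (i + 1) = s i * p i`. -/
def liftHom (hp : ∀ i, p (i + 1) = s i * p i) (i : Fin (n + 1)) :
    ((s i • r (α i)).1 ⟶ (r (α (i + 1))).1) →ₗ[k]
      ((p i)⁻¹ • (r (α i)).1 ⟶ (p (i + 1))⁻¹ • (r (α (i + 1))).1) :=
  -- Translating by `(p (i + 1))⁻¹` puts the target in the right place; the source becomes `(p (i +
  -- 1))⁻¹ • s i • u`, which is `(p i)⁻¹ • u` by the recursion.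
  Linear.leftComp k _ (eqToHom (by
    change _ = (p (i + 1))⁻¹ • s i • (r (α i)).1
    rw [hp, smul_smul]
    group)) ∘ₗ GKCategory.act (p (i + 1))⁻¹

theorem liftHom_heq (hp : ∀ i, p (i + 1) = s i * p i) (i : Fin (n + 1))
    (f : (s i • r (α i)).1 ⟶ (r (α (i + 1))).1) :
    HEq (liftHom k r hp i f) (GKCategory.act (k := k) (p (i + 1))⁻¹ f) := by
  rw [liftHom]
  exact eqToHom_comp_heq _ _

/-- The elementary chain of `C` that lifts a string of homogeneous morphisms. -/
def liftChain (hp : ∀ i, p (i + 1) = s i * p i)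
    (f : ∀ i, (s i • r (α i)).1 ⟶ (r (α (i + 1))).1) : Chains k C n :=
  elem k (x := fun i => (p i)⁻¹ • (r (α i)).1) fun i => liftHom k r hp i (f i)

/-- The constant `c = (q 0)⁻¹ * p 0` satisfies `c * (p i)⁻¹ = (q i)⁻¹` for all `i`, so acting by `c`
carries the lift along `p` to the lift along `q`. This is why lifting is well defined only after
passing to coinvariants. -/
theorem mk_liftChain_eq {q : Fin (n + 1) → G} (hp : ∀ i, p (i + 1) = s i * p i)
    (hq : ∀ i, q (i + 1) = s i * q i) (f : ∀ i, (s i • r (α i)).1 ⟶ (r (α (i + 1))).1) :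
    Representation.Coinvariants.mk (chainsRep k G C n) (liftChain k r hp f) =
      Representation.Coinvariants.mk (chainsRep k G C n) (liftChain k r hq f) := by
  have hc : ∀ i, ((q 0)⁻¹ * p 0) * (p i)⁻¹ = (q i)⁻¹ := fun i => by
    rw [← inv_mul_eq_of_cyclic hp hq i, mul_inv_cancel_right]
  rw [← Representation.Coinvariants.mk_self_apply _ ((q 0)⁻¹ * p 0), liftChain, chainsRep_elem]
  have hx : ∀ i, ((q 0)⁻¹ * p 0) • (p i)⁻¹ • (r (α i)).1 = (q i)⁻¹ • (r (α i)).1 := fun i => by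
    rw [smul_smul, hc]
  refine congrArg _ (elem_congr (funext hx) (Function.hfunext rfl ?_))
  rintro i _ ⟨⟩
  refine (act_heq_act k _ ?_ rfl (liftHom_heq k r hp i (f i))).trans
    ((act_mul_heq k _ _ _).symm.trans ((act_heq_of_eq k (hc _) _).trans
      (liftHom_heq k r hq i (f i)).symm))
  change _ = (p (i + 1))⁻¹ • s i • (r (α i)).1
  rw [hp, smul_smul]
  group

variable (α s) in
open Classical in
/-- The class of the lift of a string of homogeneous morphisms of degrees `s`, if the total degree
is trivial, and otherwise zero. -/
def liftMultilinear : MultilinearMap k (fun i => ((s i • r (α i)).1 ⟶ (r (α (i + 1))).1))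
    (chainsRep k G C n).Coinvariants :=
  -- Solvability is equivalent to total degree `1`. The solution picked by `h.choose` is arbitrary,
  -- which is harmless by `mk_liftChain_eq`; the value zero elsewhere only serves to define the map
  -- on all chains of `C/G`.
  if h : ∃ p : Fin (n + 1) → G, ∀ i, p (i + 1) = s i * p i then
    ((Representation.Coinvariants.mk (chainsRep k G C n) ∘ₗ
      DirectSum.lof k (Fin (n + 1) → C) (fun x => ⨂[k] i, (x i ⟶ x (i + 1)))
        (fun i => (h.choose i)⁻¹ • (r (α i)).1)).compMultilinearMap
          (PiTensorProduct.tprod k)).compLinearMap (liftHom k r h.choose_spec)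
  else 0

theorem liftMultilinear_apply (hp : ∀ i, p (i + 1) = s i * p i)
    (f : ∀ i, (s i • r (α i)).1 ⟶ (r (α (i + 1))).1) :
    liftMultilinear k r α s f =
      Representation.Coinvariants.mk (chainsRep k G C n) (liftChain k r hp f) := by
  have h : ∃ p : Fin (n + 1) → G, ∀ i, p (i + 1) = s i * p i := ⟨p, hp⟩
  rw [liftMultilinear, dif_pos h, mk_liftChain_eq k r hp h.choose_spec]
  rfl

/-! ### The lifting map on chains of the quotient category -/

variable [IsCancelSMul G C]

variable (n) in
open Classical in
/-- The map from the chains of `C/G` to the coinvariants of the chains of `C` that sends a string of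
homogeneous morphisms to the class of a lift, if there is one, and otherwise to zero. -/
def liftChains : Chains k (OrbitCategory k G C) n →ₗ[k] (chainsRep k G C n).Coinvariants :=
  -- `Orbit.toDeg` splits each morphism into homogeneous components, and `fromDirectSumEquiv` glues
  -- the multilinear maps given for each string of degrees `s`.
  DirectSum.toModule k _ _ fun α => PiTensorProduct.lift
    ((MultilinearMap.fromDirectSumEquiv (R := k) fun s => liftMultilinear k r α s).compLinearMap
      fun i => Orbit.toDeg k r (α i) (α (i + 1)))

theorem liftChains_elem_eq {x : Fin (n + 1) → OrbitCategory k G C} (φ : ∀ i, x i ⟶ x (i + 1)) :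
    liftChains k r n (elem k φ) =
      MultilinearMap.fromDirectSumEquiv (R := k) (fun s => liftMultilinear k r x s)
        (fun i => Orbit.toDeg k r (x i) (x (i + 1)) (φ i)) := by
  classical
  rw [elem, liftChains, toModule_lof, PiTensorProduct.lift.tprod]
  rfl

/-- On homogeneous morphisms the decomposition into degrees has a single term, so only the string of
degrees `s` contributes, and any solution `p` may be used to evaluate it. -/
theorem liftChains_elem {φ : ∀ i, Orbit.Hom k (α i) (α (i + 1))} (hp : ∀ i, p (i + 1) = s i * p i)
    (f : ∀ i, (s i • r (α i)).1 ⟶ (r (α (i + 1))).1)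
    (hf : ∀ i, φ i = Orbit.cls k (s i • r (α i)) (r (α (i + 1))) (f i)) :
    liftChains k r n (elem k (C := OrbitCategory k G C) (x := α) φ) =
      Representation.Coinvariants.mk (chainsRep k G C n) (liftChain k r hp f) := by
  classical
  have h : ∀ i, Orbit.toDeg k r (α i) (α (i + 1)) (φ i) =
      lof k G (fun s => ((s • r (α i)).1 ⟶ (r (α (i + 1))).1)) (s i) (f i) := fun i => by
    rw [hf i, ← Orbit.toDeg_ofDeg k r (α i) (α (i + 1)) (lof k G _ (s i) (f i)), Orbit.ofDeg,
      toModule_lof]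
  refine (liftChains_elem_eq k r (x := α) φ).trans ?_
  rw [funext h, MultilinearMap.fromDirectSumEquiv_lof, liftMultilinear_apply k r hp]

/-- Every string in `C` becomes homogeneous in `C/G`, of trivial total degree, and is the lift of
its image. -/
theorem exists_liftChain_eq (x : Fin (n + 1) → C) (f : ∀ i, x i ⟶ x (i + 1)) :
    ∃ (s p : Fin (n + 1) → G) (hp : ∀ i, p (i + 1) = s i * p i)
      (g : ∀ i, (s i • r (orbitMk G (x i))).1 ⟶ (r (orbitMk G (x (i + 1)))).1),
      (∀ i, (galoisCovering k G C).map (f i) =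
        Orbit.cls k (s i • r (orbitMk G (x i))) (r (orbitMk G (x (i + 1)))) (g i)) ∧
      liftChain k r (α := fun i => orbitMk G (x i)) hp g = elem k f := by
  let α : Fin (n + 1) → orbitRel.Quotient G C := fun i => orbitMk G (x i)
  let y : ∀ i, (α i).orbit := fun i => toOrbit G (x i)
  let p : Fin (n + 1) → G := fun i => Orbit.shift (y i) (r (α i))
  have hpy : ∀ i, p i • y i = r (α i) := fun i => Orbit.shift_smul _ _
  have hpx : ∀ i, (p i)⁻¹ • (r (α i)).1 = x i := fun i => by
    rw [← hpy]
    exact inv_smul_smul (p i) (x i)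
  -- The degrees are forced by the recursion; with them `p (i + 1)` sends `x i` to `s i • u i`, the
  -- source required of a representative of degree `s i`.
  let s : Fin (n + 1) → G := fun i => p (i + 1) * (p i)⁻¹
  have hs : ∀ i, s i • r (α i) = p (i + 1) • y i := fun i => by
    rw [← hpy, smul_smul, inv_mul_cancel_right]
  have hp : ∀ i, p (i + 1) = s i * p i := fun i => (inv_mul_cancel_right _ _).symm
  let g : ∀ i, (s i • r (α i)).1 ⟶ (r (α (i + 1))).1 := fun i =>
    eqToHom (congrArg Subtype.val (hs i)) ≫
      Orbit.act k (p (i + 1)) (x := y i) (y := y (i + 1)) (f i) ≫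
      eqToHom (congrArg Subtype.val (hpy (i + 1)))
  have hg : ∀ i, HEq (g i) (GKCategory.act (k := k) (p (i + 1)) (f i)) := fun i =>
    eqToHom_heq _ _ _
  refine ⟨s, p, hp, g, fun i => ?_, ?_⟩
  · exact (Orbit.cls_act k (p (i + 1)) (y i) (y (i + 1)) (f i)).symm.trans
      (Orbit.cls_congr (hs i).symm (hpy (i + 1)) (hg i).symm)
  · refine elem_congr (funext hpx) (Function.hfunext rfl ?_)
    rintro i _ ⟨⟩
    -- Lifting translates by `(p (i + 1))⁻¹`, which undoes the translation by `p (i + 1)` in `g i`.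
    refine (liftHom_heq k r hp i (g i)).trans
      ((act_heq_act k _ (congrArg Subtype.val (hs i)) (congrArg Subtype.val (hpy _)).symm
        (hg i)).trans (act_inv_act_heq k _ _))

/-- A string in `C` is itself one of the lifts of its image, so projecting and lifting back changes
nothing modulo `G`. This yields injectivity on coinvariants. -/
theorem liftChains_mapChains (c : Chains k C n) :
    liftChains k r n (mapChains k (galoisCovering k G C) n c) =
      Representation.Coinvariants.mk (chainsRep k G C n) c := by
  refine LinearMap.congr_fun
    (f := liftChains k r n ∘ₗ mapChains k (galoisCovering k G C) n)
    (g := Representation.Coinvariants.mk (chainsRep k G C n)) (chains_hom_ext fun x f => ?_) c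
  obtain ⟨s, p, hp, g, hg, h⟩ := exists_liftChain_eq (k := k) r x f
  rw [LinearMap.comp_apply, mapChains_elem, ← h]
  exact liftChains_elem k r hp g hg

/-- The lift is made of translates of the representatives `f i`, and a translate has the same class
in `C/G`. This yields surjectivity onto the component of trivial degree. -/
theorem mapChains_liftChain {φ : ∀ i, Orbit.Hom k (α i) (α (i + 1))}
    (hp : ∀ i, p (i + 1) = s i * p i)
    (f : ∀ i, (s i • r (α i)).1 ⟶ (r (α (i + 1))).1)
    (hf : ∀ i, φ i = Orbit.cls k (s i • r (α i)) (r (α (i + 1))) (f i)) :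
    mapChains k (galoisCovering k G C) n (liftChain k r hp f) =
      elem k (C := OrbitCategory k G C) (x := α) φ := by
  rw [liftChain, mapChains_elem]
  have hx : ∀ i, (galoisCovering k G C).obj ((p i)⁻¹ • (r (α i)).1) = α i := fun i =>
    orbitRel.Quotient.mem_orbit.mp ((p i)⁻¹ • r (α i)).2
  refine elem_congr (funext hx) (Function.hfunext rfl ?_)
  rintro i _ ⟨⟩
  have e : (p i)⁻¹ • r (α i) = (p (i + 1))⁻¹ • s i • r (α i) := by
    rw [hp, smul_smul]
    group
  refine (galoisCovering_map_heq k ((p i)⁻¹ • r (α i)) ((p (i + 1))⁻¹ • r (α (i + 1)))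
    (liftHom k r hp i (f i))).trans (heq_of_eq ?_)
  rw [hf i, ← Orbit.cls_act k (p (i + 1))⁻¹]
  exact Orbit.cls_congr e rfl (liftHom_heq k r hp i (f i))

/-- The objects `y` and `t • y` have the same orbit, and a morphism and its translate have the same
class; hence the chain map descends to coinvariants. -/
theorem mapChains_chainsRep (t : G) (c : Chains k C n) :
    mapChains k (galoisCovering k G C) n (chainsRep k G C n t c) =
      mapChains k (galoisCovering k G C) n c := by
  refine LinearMap.congr_fun
    (f := mapChains k (galoisCovering k G C) n ∘ₗ chainsRep k G C n t)
    (g := mapChains k (galoisCovering k G C) n) (chains_hom_ext fun x f => ?_) c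
  rw [LinearMap.comp_apply, chainsRep_elem, mapChains_elem, mapChains_elem]
  have hx : ∀ y : C, (galoisCovering k G C).obj (t • y) = (galoisCovering k G C).obj y := fun y =>
    orbitRel.Quotient.mem_orbit.mp (t • toOrbit G y).2
  refine elem_congr (funext fun i => hx (x i)) (Function.hfunext rfl ?_)
  rintro i _ ⟨⟩
  exact (galoisCovering_map_heq k (t • toOrbit G (x i)) (t • toOrbit G (x (i + 1))) _).trans
    (heq_of_eq (Orbit.cls_act k t (toOrbit G (x i)) (toOrbit G (x (i + 1))) (f i)))

end Lift

/-! ### The component of trivial degree and the coinvariants -/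

section Comparison
variable (k G C : Type u) [Field k] [Group G] [Category.{u} C] [Preadditive C] [Linear k C]
  [MulAction G C] [GKCategory k G C]

/-- If the functor of coinvariants is exact, it commutes with homology. -/
theorem nonempty_homology_coinvariantsChainComplex_iso (h : CoinvariantsExact k G) (n : ℕ) :
    Nonempty ((coinvariantsChainComplex k G C).homology n ≅
      (Rep.coinvariantsFunctor k G).obj (homologyRep k G C n)) := by
  -- Among the equivalent forms of exactness, entry 0 is preservation of short exact sequences, the
  -- hypothesis `h`, and entry 2 is preservation of homology.
  have : (Rep.coinvariantsFunctor k G).PreservesHomology :=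
    ((Rep.coinvariantsFunctor k G).exact_tfae.out 0 2).mp h
  exact ⟨((chainComplexRep k G C).sc n).mapHomologyIso (Rep.coinvariantsFunctor k G)⟩

variable [IsCancelSMul G C] {T : Set C} (hT : IsTransversal G T)

theorem mapChains_mem_conjChains (n : ℕ) (c : Chains k C n) :
    mapChains k (galoisCovering k G C) n c ∈
      (orbitGrading k G C hT).conjChains (ConjClasses.mk 1) n := by
  -- Membership is recast as the vanishing of a linear map to the quotient, so that it can be
  -- checked on elementary chains.
  have h : ((orbitGrading k G C hT).conjChains (ConjClasses.mk 1) n).mkQ ∘ₗ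
      mapChains k (galoisCovering k G C) n = 0 := chains_hom_ext fun x f => by
    obtain ⟨s, p, hp, g, hg, -⟩ := exists_liftChain_eq (k := k) hT.rep x f
    rw [LinearMap.comp_apply, mapChains_elem, LinearMap.zero_apply, Submodule.mkQ_apply,
      Submodule.Quotient.mk_eq_zero]
    exact Submodule.subset_span ⟨_, _, s, fun i => ⟨g i, (hg i).symm⟩,
      congrArg _ (totalDegree_eq_one hp), rfl⟩
  exact (Submodule.Quotient.mk_eq_zero _).mp (LinearMap.congr_fun h c)

/-- The component is spanned by homogeneous strings of trivial total degree, and each of these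
lifts. -/
theorem conjChains_le_range (n : ℕ) :
    (orbitGrading k G C hT).conjChains (ConjClasses.mk 1) n ≤
      LinearMap.range (mapChains k (galoisCovering k G C) n) := by
  refine Submodule.span_le.mpr ?_
  rintro _ ⟨x, φ, s, hφ, hs, rfl⟩
  -- The conjugacy class of `1` contains only `1`, so the total degree is trivial and the recursion
  -- for `p` can be solved.
  obtain ⟨p, hp⟩ := exists_of_totalDegree_eq_one
    (isConj_one_left.mp (ConjClasses.mk_eq_mk_iff_isConj.mp hs))
  choose g hg using hφ
  exact ⟨_, mapChains_liftChain k hT.rep hp g fun i => (hg i).symm⟩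

/-- The map on chains induced by the covering, with values in the component of trivial degree. -/
def toConjChains (n : ℕ) : Chains k C n →ₗ[k]
    (orbitGrading k G C hT).conjChains (ConjClasses.mk 1) n :=
  (mapChains k (galoisCovering k G C) n).codRestrict _ (mapChains_mem_conjChains k G C hT n)

/-- The covering induces a map from the coinvariants of the chains of `C` to the component of
trivial degree of the chains of `C/G`. -/
def coinvariantsToConjChains (n : ℕ) : (chainsRep k G C n).Coinvariants →ₗ[k]
    (orbitGrading k G C hT).conjChains (ConjClasses.mk 1) n :=
  Representation.Coinvariants.lift
    (W := (orbitGrading k G C hT).conjChains (ConjClasses.mk 1) n) (chainsRep k G C n)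
    (toConjChains k G C hT n) fun t => LinearMap.ext fun c => Subtype.ext (mapChains_chainsRep k t c)

theorem bijective_coinvariantsToConjChains (n : ℕ) :
    Function.Bijective (coinvariantsToConjChains k G C hT n) := by
  constructor
  -- Lifting is needed only as a one-sided inverse; surjectivity is proved separately on generators.
  · refine Function.LeftInverse.injective (g := fun c => liftChains k hT.rep n c.1) fun v => ?_
    obtain ⟨c, rfl⟩ := Representation.Coinvariants.mk_surjective _ v
    exact liftChains_mapChains k hT.rep c
  · rintro ⟨c, hc⟩
    obtain ⟨c, rfl⟩ := conjChains_le_range k G C hT n hc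
    exact ⟨Representation.Coinvariants.mk _ c, Subtype.ext rfl⟩

/-- The coinvariants of the Hochschild-Mitchell complex of `C` are isomorphic to the component of
trivial degree of the Hochschild-Mitchell complex of `C/G`. -/
def coinvariantsIsoConj : coinvariantsChainComplex k G C ≅
    (orbitGrading k G C hT).conjChainComplex (ConjClasses.mk 1) :=
  HomologicalComplex.Hom.isoOfComponents
    (fun n => (LinearEquiv.ofBijective (coinvariantsToConjChains k G C hT n)
      (bijective_coinvariantsToConjChains k G C hT n)).toModuleIso) (by
    rintro _ n rfl
    have h1 : (coinvariantsChainComplex k G C).d (n + 1) n = (Rep.coinvariantsFunctor k G).map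
        (Rep.ofHom ⟨boundary k C n, boundary_chainsRep k G C n⟩) :=
      congrArg (Rep.coinvariantsFunctor k G).map (ChainComplex.of_d
        (fun n => Rep.of (chainsRep k G C n))
        (fun n => Rep.ofHom ⟨boundary k C n, boundary_chainsRep k G C n⟩) n)
    have h2 : ((orbitGrading k G C hT).conjChainComplex (ConjClasses.mk 1)).d (n + 1) n =
        ModuleCat.ofHom ((boundary k _ n).restrict
          ((orbitGrading k G C hT).boundary_mem_conjChains (ConjClasses.mk 1) n)) :=
      ChainComplex.of_d
        (fun n => ModuleCat.of k ((orbitGrading k G C hT).conjChains (ConjClasses.mk 1) n))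
        (fun n => ModuleCat.ofHom ((boundary k _ n).restrict
          ((orbitGrading k G C hT).boundary_mem_conjChains (ConjClasses.mk 1) n))) n
    rw [h1, h2]
    -- A map out of coinvariants is determined on representatives, where the square says that the
    -- functor commutes with the boundary.
    refine Rep.coinvariantsFunctor_hom_ext (ModuleCat.hom_ext (LinearMap.ext fun c =>
      Subtype.ext ?_))
    exact boundary_mapChains k (galoisCovering k G C) n c)

end Comparison

end

end HochschildMitchell

theorem mainTheorem8 (k G C : Type u) [Field k] [Group G] [CategoryTheory.Category.{u} C]
    [CategoryTheory.Preadditive C] [CategoryTheory.Linear k C] [MulAction G C]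
    [HochschildMitchell.GKCategory k G C] [IsCancelSMul G C]
    (T : Set C) (hT : HochschildMitchell.IsTransversal G T) :
    (∀ n : ℕ, Nonempty
      ((HochschildMitchell.orbitGrading k G C hT).conjHomology (ConjClasses.mk 1) n ≃ₗ[k]
        (HochschildMitchell.coinvariantsChainComplex k G C).homology n)) ∧
    (HochschildMitchell.CoinvariantsExact k G → ∀ n : ℕ, Nonempty
      ((HochschildMitchell.orbitGrading k G C hT).conjHomology (ConjClasses.mk 1) n ≃ₗ[k]
        (Rep.coinvariantsFunctor k G).obj (HochschildMitchell.homologyRep k G C n))) := by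
  have e := HochschildMitchell.coinvariantsIsoConj k G C hT
  have h (n : ℕ) := (HomologicalComplex.homologyFunctor _ _ n).mapIso e.symm
  exact ⟨fun n => ⟨(h n).toLinearEquiv⟩, fun hex n =>
    (HochschildMitchell.nonempty_homology_coinvariantsChainComplex_iso k G C hex n).map
      fun i => (h n ≪≫ i).toLinearEquiv⟩
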